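/- Let $n\ge 3$, $k\ge 2$, let $M$ be a connected smooth $n$-manifold and let $h_{ij}$ be a smooth pseudo-Riemannian metric on $M$ (of any signature) with Levi-Civita connection $D$; indices are raised with $h$, and brackets $[ij]$ denote antisymmetrization (with factor $\tfrac12$). The curvature $R_{ijk}{}^{l}$ is defined by $(D_iD_j-D_jD_i)X^l=R_{ijk}{}^{l}X^k$, and $R_{ijkl}=R_{ijk}{}^{p}h_{pl}$, $R_{ij}=R_{pij}{}^{p}$, $R_h=h^{ij}R_{ij}$. For a tensor $Y_{ijkl}$ put $\mathrm{Ric}(Y)_{ij}=Y_{pij}{}^{p}$. For completely symmetric tensors $\alpha,\beta$ of the same rank $r\ge 2$ put $$(\alpha\wedge\beta)_{ijkl}=\alpha_{k[i}{}^{p_1\dots p_{r-2}}\beta_{j]lp_1\dots p_{r-2}}-\alpha_{l[i}{}^{p_1\dots p_{r-2}}\beta_{j]kp_1\dots p_{r-2}},$$ so that $(h\wedge h)_{ijkl}=2h_{k[i}h_{j]l}$. Let $\omega$ be a smooth completely symmetric, $h$-trace-free covariant tensor field of rank $k$. Put $|\omega|_h^2=\omega^{p_1\dots p_k}\omega_{p_1\dots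 p_k}$, $\mathrm{div}(\omega)_{i_1\dots i_{k-1}}=D^p\omega_{pi_1\dots i_{k-1}}$, and let $$\mathcal K(\omega)_{iji_1\dots i_{k-1}}=D_{[i}\omega_{j]i_1\dots i_{k-1}}-\tfrac{1}{n+k-3}\sum_{s=1}^{k-1}h_{i_s[i}\,\mathrm{div}(\omega)_{j]i_1\dots\hat{i}_s\dots i_{k-1}}$$ be the trace-free part of $D_{[i}\omega_{j]i_1\dots i_{k-1}}$. For $c\in\mathbb R$ and $\kappa\in C^\infty(M)$ consider the equation $$R_{ijkl}-c(\omega\wedge\omega)_{ijkl}=-\tfrac{\kappa}{n(n-1)}(h\wedge h)_{ijkl},\tag{1}$$ and, for $c\in\mathbb R$ and a real constant $\kappa$, the coupled Einstein system $$\begin{aligned}0&=-2(n+k-3)\,\omega^{p_1\dots p_k}\mathcal K(\omega)_{ip_1\dots p_k}+(n-2)\,\omega_i{}^{p_1\dots p_{k-1}}\mathrm{div}(\omega)_{p_1\dots p_{k-1}},\\ R_{ij}&-\tfrac12R_hh_{ij}+\tfrac{n-2}{2n}\kappa h_{ij}=c\left(\mathrm{Ric}(\omega\wedge\omega)_{ij}-\tfrac12|\omega|_h^2h_{ij}\right).\end{aligned}\tag{2}$$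 (a) Suppose $\mathrm{div}(\omega)=0$ and $\omega^{p_1\dots p_k}\mathcal K(\omega)_{ip_1\dots p_k}=0$. If $c\in\mathbb R$ and $\kappa\in C^\infty(M)$ satisfy (1), then $\kappa$ is constant and $(h,\omega)$ solves (2) with the same $c$ and $\kappa$. (b) Suppose $n=3$. If $(h,\omega)$ solves (2) with real constants $c$ and $\kappa$, then it solves (1) with the same $c$ and $\kappa$. If moreover $\mathrm{div}(\omega)=0$ and $\omega^{p_1\dots p_k}\mathcal K(\omega)_{ip_1\dots p_k}=0$, then for all $c\in\mathbb R$ and $\kappa\in C^\infty(M)$, (1) holds if and only if $\kappa$ is constant and (2) holds with the same $c$ and $\kappa$. -/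

import Mathlib

open scoped Manifold ContDiff

noncomputable section

namespace EinsteinTensor

/-! ### Algebra of component arrays

A covariant `k`-tensor on an `n`-dimensional space is recorded, with respect to a basis, by its
components `T : (Fin k → Fin n) → ℝ`; the array `g : Matrix (Fin n) (Fin n) ℝ` holds the components
`h^{ij}` of the inverse metric, with which indices are raised. -/

/-- Complete contraction `⟨A, B⟩ = A^{p₁…p_k} B_{p₁…p_k}`. -/
def contr {n k : ℕ} (g : Matrix (Fin n) (Fin n) ℝ) (A B : (Fin k → Fin n) → ℝ) : ℝ :=
  ∑ P : Fin k → Fin n, ∑ Q : Fin k → Fin n, (∏ s, g (P s) (Q s)) * A P * B Q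

/-- `A_{ij}^{p₁…p_m} B_{kl p₁…p_m}` for tensors of rank `m + 2`. -/
def pairContr {n m : ℕ} (g : Matrix (Fin n) (Fin n) ℝ) (A B : (Fin (m + 2) → Fin n) → ℝ)
    (i j k l : Fin n) : ℝ :=
  contr g (fun P : Fin m → Fin n => A (Matrix.vecCons i (Matrix.vecCons j P)))
    (fun P : Fin m → Fin n => B (Matrix.vecCons k (Matrix.vecCons l P)))

/-- The (generalized Kulkarni–Nomizu) product
`(A ∧ B)_{ijkl} = A_{k[i}^{P} B_{j]lP} - A_{l[i}^{P} B_{j]kP}`, where `[ij]` denotes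
antisymmetrization with the factor `1/2`. -/
def kwedge {n m : ℕ} (g : Matrix (Fin n) (Fin n) ℝ) (A B : (Fin (m + 2) → Fin n) → ℝ)
    (i j k l : Fin n) : ℝ :=
  (1 / 2) * (pairContr g A B k i j l - pairContr g A B k j i l)
    - (1 / 2) * (pairContr g A B l i j k - pairContr g A B l j i k)

/-- Ricci trace `Ric(Y)_{ij} = Y_{pij}^p`. -/
def ricTr {n : ℕ} (g : Matrix (Fin n) (Fin n) ℝ) (Y : Fin n → Fin n → Fin n → Fin n → ℝ)
    (i j : Fin n) : ℝ :=
  ∑ p, ∑ q, g p q * Y p i j q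

/-! ### Tensor fields and metrics on a manifold -/

/-- Coordinate vector field `∂_i` of the chart `e`, at the point with coordinates `u`. -/
def coordVec {n : ℕ} {M : Type*} [TopologicalSpace M] [ChartedSpace (EuclideanSpace ℝ (Fin n)) M]
    (e : OpenPartialHomeomorph M (EuclideanSpace ℝ (Fin n))) (u : EuclideanSpace ℝ (Fin n))
    (i : Fin n) : TangentSpace (𝓡 n) (e.symm u) :=
  mfderiv (𝓡 n) (𝓡 n) e.symm u (EuclideanSpace.single i (1 : ℝ))

/-- Covariant tensor fields of rank `k` (no regularity). -/
abbrev TensorField (n : ℕ) (M : Type*) [TopologicalSpace M]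
    [ChartedSpace (EuclideanSpace ℝ (Fin n)) M] (k : ℕ) : Type _ :=
  ∀ x : M, MultilinearMap ℝ (fun _ : Fin k => TangentSpace (𝓡 n) x) ℝ

/-- Components `α_{a₁…a_k}` in the chart `e`, as functions of the coordinates `u`. -/
def comp {n : ℕ} {M : Type*} [TopologicalSpace M] [ChartedSpace (EuclideanSpace ℝ (Fin n)) M]
    {k : ℕ} (α : TensorField n M k) (e : OpenPartialHomeomorph M (EuclideanSpace ℝ (Fin n)))
    (u : EuclideanSpace ℝ (Fin n)) (a : Fin k → Fin n) : ℝ :=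
  α (e.symm u) (fun s => coordVec e u (a s))

/-- A smooth pseudo-Riemannian metric (of arbitrary signature): a smooth section of nondegenerate
symmetric bilinear forms on the tangent spaces. -/
structure PseudoRiemannianMetric (n : ℕ) (M : Type*) [TopologicalSpace M]
    [ChartedSpace (EuclideanSpace ℝ (Fin n)) M] where
  form : ∀ x : M, TangentSpace (𝓡 n) x →ₗ[ℝ] TangentSpace (𝓡 n) x →ₗ[ℝ] ℝ
  symm : ∀ x v w, form x v w = form x w v
  nondegenerate : ∀ x v, (∀ w, form x v w = 0) → v = 0
  smooth : ∀ e ∈ IsManifold.maximalAtlas (𝓡 n) ∞ M, ∀ i j : Fin n,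
    ContDiffOn ℝ ∞ (fun u => form (e.symm u) (coordVec e u i) (coordVec e u j)) e.target

section Local

variable {n : ℕ} {M : Type*} [TopologicalSpace M] [ChartedSpace (EuclideanSpace ℝ (Fin n)) M]
  (h : PseudoRiemannianMetric n M) (e : OpenPartialHomeomorph M (EuclideanSpace ℝ (Fin n)))

/-- Components `h_{ij}` of the metric. -/
def metric (u : EuclideanSpace ℝ (Fin n)) : Matrix (Fin n) (Fin n) ℝ :=
  Matrix.of fun i j => h.form (e.symm u) (coordVec e u i) (coordVec e u j)

/-- Components `h^{ij}` of the inverse metric. -/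
def invMetric (u : EuclideanSpace ℝ (Fin n)) : Matrix (Fin n) (Fin n) ℝ := (metric h e u)⁻¹

/-- The metric as a component array of rank two. -/
def metricArr (u : EuclideanSpace ℝ (Fin n)) (a : Fin (0 + 2) → Fin n) : ℝ :=
  metric h e u (a 0) (a 1)

/-- Partial derivative `∂_i f`. -/
def pd (i : Fin n) (f : EuclideanSpace ℝ (Fin n) → ℝ) (u : EuclideanSpace ℝ (Fin n)) : ℝ :=
  fderiv ℝ f u (EuclideanSpace.single i (1 : ℝ))

/-- Christoffel symbols `Γ^k_{ij}` of the Levi-Civita connection `D`. -/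
def christoffel (u : EuclideanSpace ℝ (Fin n)) (k i j : Fin n) : ℝ :=
  (1 / 2) * ∑ l, invMetric h e u k l *
    (pd i (fun v => metric h e v j l) u + pd j (fun v => metric h e v i l) u
      - pd l (fun v => metric h e v i j) u)

/-- Curvature `R_{ijk}^l`, where `(D_i D_j - D_j D_i) X^l = R_{ijk}^l X^k`. -/
def riemannUp (u : EuclideanSpace ℝ (Fin n)) (i j k l : Fin n) : ℝ :=
  pd i (fun v => christoffel h e v l j k) u - pd j (fun v => christoffel h e v l i k) u
    + ∑ p, (christoffel h e u l i p * christoffel h e u p j k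
        - christoffel h e u l j p * christoffel h e u p i k)

/-- `R_{ijkl} = R_{ijk}^p h_{pl}`. -/
def riemann (u : EuclideanSpace ℝ (Fin n)) (i j k l : Fin n) : ℝ :=
  ∑ p, riemannUp h e u i j k p * metric h e u p l

/-- Ricci curvature `R_{ij} = R_{pij}^p`. -/
def ricci (u : EuclideanSpace ℝ (Fin n)) (i j : Fin n) : ℝ :=
  ricTr (invMetric h e u) (riemann h e u) i j

/-- Scalar curvature `R_h = h^{ij} R_{ij}`. -/
def scalar (u : EuclideanSpace ℝ (Fin n)) : ℝ :=
  ∑ i, ∑ j, invMetric h e u i j * ricci h e u i j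

/-- Covariant derivative `D_i α_{a₁…a_k} = ∂_i α_{a₁…a_k} - ∑_s Γ^p_{i a_s} α_{a₁…p…a_k}`, with `p`
in place `s`. -/
def covDeriv {k : ℕ} (α : TensorField n M k) (u : EuclideanSpace ℝ (Fin n)) (i : Fin n)
    (a : Fin k → Fin n) : ℝ :=
  pd i (fun v => comp α e v a) u
    - ∑ s, ∑ p, christoffel h e u p i (a s) * comp α e u (Function.update a s p)

/-- Divergence `div(α)_A = D^p α_{pA}`. -/
def divergence {m : ℕ} (α : TensorField n M (m + 1)) (u : EuclideanSpace ℝ (Fin n))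
    (A : Fin m → Fin n) : ℝ :=
  ∑ p, ∑ q, invMetric h e u p q * covDeriv h e α u p (Matrix.vecCons q A)

/-- For trace-free symmetric `α` of rank `k = m + 2`, the completely trace-free part of
`D_{[i} α_{j] a₁…a_{k-1}}`:
`K(α)_{ijA} = D_{[i} α_{j]A} - (n+k-3)⁻¹ ∑_s h_{a_s [i} div(α)_{j] A∖a_s}`. -/
def klie {m : ℕ} (α : TensorField n M (m + 2)) (u : EuclideanSpace ℝ (Fin n)) (i j : Fin n)
    (A : Fin (m + 1) → Fin n) : ℝ :=
  (1 / 2) * (covDeriv h e α u i (Matrix.vecCons j A) - covDeriv h e α u j (Matrix.vecCons i A))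
    - (1 / ((n : ℝ) + ((m : ℝ) + 2) - 3)) * ∑ s : Fin (m + 1),
      (1 / 2) *
        (metric h e u (A s) i * divergence h e α u (Matrix.vecCons j (fun t => A (s.succAbove t)))
        - metric h e u (A s) j * divergence h e α u (Matrix.vecCons i (fun t => A (s.succAbove t))))

/-- The one-form `α^{a₁…a_k} K(α)_{i a₁…a_k}`. -/
def klieCons {m : ℕ} (α : TensorField n M (m + 2)) (u : EuclideanSpace ℝ (Fin n))
    (i : Fin n) : ℝ :=
  contr (invMetric h e u) (comp α e u) (fun P => klie h e α u i (P 0) (fun s => P s.succ))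

/-- The one-form `α_i^{a₁…a_{k-1}} div(α)_{a₁…a_{k-1}}`. -/
def divCons {m : ℕ} (α : TensorField n M (m + 2)) (u : EuclideanSpace ℝ (Fin n))
    (i : Fin n) : ℝ :=
  contr (invMetric h e u) (fun A => comp α e u (Matrix.vecCons i A)) (divergence h e α u)

/-- The product `(α ∧ α)_{ijkl}`. -/
def omegaWedge {m : ℕ} (α : TensorField n M (m + 2)) (u : EuclideanSpace ℝ (Fin n))
    (i j k l : Fin n) : ℝ :=
  kwedge (invMetric h e u) (comp α e u) (comp α e u) i j k l

/-- `|α|²_h = α^{a₁…a_k} α_{a₁…a_k}`. -/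
def normSq {k : ℕ} (α : TensorField n M k) (u : EuclideanSpace ℝ (Fin n)) : ℝ :=
  contr (invMetric h e u) (comp α e u) (comp α e u)

/-- The stress-energy tensor `Ric(α ∧ α)_{ij} - ½ |α|²_h h_{ij}`. -/
def stressPlus {m : ℕ} (α : TensorField n M (m + 2)) (u : EuclideanSpace ℝ (Fin n))
    (i j : Fin n) : ℝ :=
  ricTr (invMetric h e u) (omegaWedge h e α u) i j - (1 / 2) * normSq h e α u * metric h e u i j

end Local

/-! ### Global notions

A tensor equation on `M` is imposed in every smooth chart, at every point of it. -/

section Global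

variable {n : ℕ} {M : Type*} [TopologicalSpace M] [ChartedSpace (EuclideanSpace ℝ (Fin n)) M]

/-- `α` is a smooth section of `S^k_0(T*M)`, the bundle of completely symmetric and `h`-trace-free
covariant tensors of rank `k = m + 2`. -/
structure IsSymTraceFree (h : PseudoRiemannianMetric n M) {m : ℕ} (α : TensorField n M (m + 2)) :
    Prop where
  smooth : ∀ e ∈ IsManifold.maximalAtlas (𝓡 n) ∞ M, ∀ a : Fin (m + 2) → Fin n,
    ContDiffOn ℝ ∞ (fun u => comp α e u a) e.target
  symm : ∀ (x : M) (σ : Equiv.Perm (Fin (m + 2))) (v : Fin (m + 2) → TangentSpace (𝓡 n) x),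
    α x (fun s => v (σ s)) = α x v
  traceFree : ∀ e ∈ IsManifold.maximalAtlas (𝓡 n) ∞ M, ∀ u ∈ e.target, ∀ A : Fin m → Fin n,
    ∑ p, ∑ q, invMetric h e u p q * comp α e u (Matrix.vecCons p (Matrix.vecCons q A)) = 0

/-- `div(α) = 0`. -/
def IsDivFree (h : PseudoRiemannianMetric n M) {m : ℕ} (α : TensorField n M (m + 2)) : Prop :=
  ∀ e ∈ IsManifold.maximalAtlas (𝓡 n) ∞ M, ∀ u ∈ e.target, ∀ A : Fin (m + 1) → Fin n,
    divergence h e α u A = 0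

/-- `α^{a₁…a_k} K(α)_{i a₁…a_k} = 0`. -/
def KlieConsVanishes (h : PseudoRiemannianMetric n M) {m : ℕ} (α : TensorField n M (m + 2)) :
    Prop :=
  ∀ e ∈ IsManifold.maximalAtlas (𝓡 n) ∞ M, ∀ u ∈ e.target, ∀ i : Fin n,
    klieCons h e α u i = 0

/-- `R_{ijkl} - c (α ∧ α)_{ijkl} = - κ / (n (n - 1)) (h ∧ h)_{ijkl}`. -/
def SolvesProjectiveHiggs (h : PseudoRiemannianMetric n M) {m : ℕ} (α : TensorField n M (m + 2))
    (c : ℝ) (κ : M → ℝ) : Prop :=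
  ∀ e ∈ IsManifold.maximalAtlas (𝓡 n) ∞ M, ∀ u ∈ e.target, ∀ i j k l : Fin n,
    riemann h e u i j k l - c * omegaWedge h e α u i j k l =
      -(κ (e.symm u) / ((n : ℝ) * ((n : ℝ) - 1))) *
        kwedge (invMetric h e u) (metricArr h e u) (metricArr h e u) i j k l

/-- The coupled Einstein system, with real constants `c` and `κ`, for `α` of rank `k = m + 2`:
`0 = -2 (n + k - 3) α^A K(α)_{iA} + (n - 2) α_i^B div(α)_B` and
`R_{ij} - ½ R_h h_{ij} + (n - 2) / (2 n) κ h_{ij} = c (Ric(α ∧ α)_{ij} - ½ |α|²_h h_{ij})`. -/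
def SolvesStressEnergy (h : PseudoRiemannianMetric n M) {m : ℕ} (α : TensorField n M (m + 2))
    (c κ : ℝ) : Prop :=
  ∀ e ∈ IsManifold.maximalAtlas (𝓡 n) ∞ M, ∀ u ∈ e.target,
    (∀ i : Fin n, 0 = -2 * ((n : ℝ) + ((m : ℝ) + 2) - 3) * klieCons h e α u i
      + ((n : ℝ) - 2) * divCons h e α u i) ∧
    (∀ i j : Fin n, ricci h e u i j - (1 / 2) * scalar h e u * metric h e u i j
      + ((n : ℝ) - 2) / (2 * (n : ℝ)) * κ * metric h e u i j = c * stressPlus h e α u i j)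

end Global

end EinsteinTensor

end

/-! Both directions compare Ricci traces. Because $\omega$ is symmetric and trace-free,
$\mathrm{Ric}(\omega\wedge\omega)_{ij}=\omega_i{}^P\omega_{jP}$, while $\mathrm{Ric}(h\wedge
h)=(1-n)h$. Hence (1) gives $R_{ij}=c\,\omega_i{}^P\omega_{jP}+\frac{\kappa}{n}h_{ij}$ and
$R_h=c|\omega|^2+\kappa$ (`SolvesProjectiveHiggs.ricci_eq`, `SolvesProjectiveHiggs.scalar_eq`), from
which the Einstein equation in (2) is algebra.

Constancy of $\kappa$ is a Schur-type argument. The contracted Bianchi identity reads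
$dR_h=2\,\mathrm{div}\,\mathrm{Ric}$ (`pd_scalar`). The conditions on $\mathrm{div}(\omega)$ and
$\mathcal K(\omega)$ give $D^c(\omega_a{}^P\omega_{cP})=\frac12 D_a|\omega|^2$
(`divMat_tailMat_eq_pd_normSq`). The terms in $|\omega|^2$ then cancel and leave
$(\frac2n-1)\,d\kappa=0$; connectedness finishes.

For $n=3$, the trace of (2) recovers $R_h=c|\omega|^2+\kappa$, so the difference of the two sides of
(1) has zero Ricci trace. It is antisymmetric in each pair of indices, and in dimension three such a
tensor is determined by its Ricci trace (`eq_zero_of_ricTr_eq_zero`).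

The differential geometry is done in one chart at a time, with the Christoffel symbols packed into
matrices $\Gamma_i$ so that the curvature identities become identities of noncommutative algebra. -/

noncomputable section

namespace EinsteinTensor

open scoped Topology Matrix

/-! ### Contractions and the Ricci traces of the wedge products. -/

section Algebra

variable {n : ℕ} {g : Matrix (Fin n) (Fin n) ℝ}

/-- Since no symmetry of `g` is needed, linearity in the left slot transfers to the right one. -/
theorem contr_transpose {k : ℕ} (g : Matrix (Fin n) (Fin n) ℝ) (A B : (Fin k → Fin n) → ℝ) :
    contr g A B = contr g.transpose B A := by
  unfold contr
  rw [Finset.sum_comm]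
  refine Finset.sum_congr rfl fun P _ => Finset.sum_congr rfl fun Q _ => ?_
  simp only [Matrix.transpose_apply]
  ring

theorem contr_comm (hg : ∀ i j, g i j = g j i) {k : ℕ} (A B : (Fin k → Fin n) → ℝ) :
    contr g A B = contr g B A := by
  rw [contr_transpose, show g.transpose = g from Matrix.ext fun i j => hg j i]

theorem contr_sum_left {ι : Type*} (s : Finset ι) {k : ℕ} (c : ι → ℝ)
    (A : ι → (Fin k → Fin n) → ℝ) (B : (Fin k → Fin n) → ℝ) :
    contr g (fun P => ∑ i ∈ s, c i * A i P) B = ∑ i ∈ s, c i * contr g (A i) B := by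
  simp only [contr, Finset.mul_sum, Finset.sum_mul]
  conv_rhs => rw [Finset.sum_comm]
  refine Finset.sum_congr rfl fun P _ => ?_
  conv_rhs => rw [Finset.sum_comm]
  refine Finset.sum_congr rfl fun Q _ => Finset.sum_congr rfl fun i _ => ?_
  ring

theorem contr_sum_right {ι : Type*} (s : Finset ι) {k : ℕ} (c : ι → ℝ)
    (A : (Fin k → Fin n) → ℝ) (B : ι → (Fin k → Fin n) → ℝ) :
    contr g A (fun P => ∑ i ∈ s, c i * B i P) = ∑ i ∈ s, c i * contr g A (B i) := by
  simp only [contr_transpose g A]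
  exact contr_sum_left s c B A

theorem contr_add_left {k : ℕ} (A A' B : (Fin k → Fin n) → ℝ) :
    contr g (fun P => A P + A' P) B = contr g A B + contr g A' B := by
  simp only [contr, ← Finset.sum_add_distrib]
  refine Finset.sum_congr rfl fun P _ => Finset.sum_congr rfl fun Q _ => ?_
  ring

theorem contr_sub_left {k : ℕ} (A A' B : (Fin k → Fin n) → ℝ) :
    contr g (fun P => A P - A' P) B = contr g A B - contr g A' B := by
  simp only [contr, ← Finset.sum_sub_distrib]
  refine Finset.sum_congr rfl fun P _ => Finset.sum_congr rfl fun Q _ => ?_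
  ring

theorem contr_smul_left {k : ℕ} (c : ℝ) (A B : (Fin k → Fin n) → ℝ) :
    contr g (fun P => c * A P) B = c * contr g A B := by
  simp only [contr, Finset.mul_sum]
  refine Finset.sum_congr rfl fun P _ => Finset.sum_congr rfl fun Q _ => ?_
  ring

theorem contr_zero_right {k : ℕ} (A : (Fin k → Fin n) → ℝ) : contr g A (fun _ => 0) = 0 := by
  simp [contr]

/-- Splitting off the first index of a complete contraction. -/
theorem contr_succ {k : ℕ} (A B : (Fin (k + 1) → Fin n) → ℝ) :
    contr g A B = ∑ p, ∑ q, g p q *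
      contr g (fun P => A (Matrix.vecCons p P)) (fun Q => B (Matrix.vecCons q Q)) := by
  unfold contr
  have h1 : ∀ F : (Fin (k + 1) → Fin n) → ℝ,
      ∑ P, F P = ∑ p : Fin n, ∑ P : Fin k → Fin n, F (Matrix.vecCons p P) := by
    intro F
    rw [← (Fin.consEquiv fun _ : Fin (k + 1) => Fin n).sum_comp, Fintype.sum_prod_type]
    rfl
  rw [h1]
  refine Finset.sum_congr rfl fun p _ => ?_
  simp only [h1 fun Q => _]
  rw [Finset.sum_comm]
  refine Finset.sum_congr rfl fun q _ => ?_
  rw [Finset.mul_sum]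
  refine Finset.sum_congr rfl fun P _ => ?_
  rw [Finset.mul_sum]
  refine Finset.sum_congr rfl fun Q _ => ?_
  rw [Fin.prod_univ_succ]
  simp only [Matrix.cons_val_zero, Matrix.cons_val_succ]
  ring

/-- The contraction `A_{iP} A_j^P`. -/
def contrTail {m : ℕ} (g : Matrix (Fin n) (Fin n) ℝ) (A : (Fin (m + 2) → Fin n) → ℝ)
    (i j : Fin n) : ℝ :=
  contr g (fun P : Fin (m + 1) → Fin n => A (Matrix.vecCons i P))
    (fun P => A (Matrix.vecCons j P))

theorem contrTail_comm (hg : ∀ i j, g i j = g j i) {m : ℕ} (A : (Fin (m + 2) → Fin n) → ℝ)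
    (i j : Fin n) : contrTail g A i j = contrTail g A j i :=
  contr_comm hg _ _

theorem sum_contrTail {m : ℕ} (A : (Fin (m + 2) → Fin n) → ℝ) :
    ∑ i, ∑ j, g i j * contrTail g A i j = contr g A A :=
  (contr_succ A A).symm

theorem swap_vecCons {m : ℕ} {A : (Fin (m + 2) → Fin n) → ℝ}
    (hA : ∀ (σ : Equiv.Perm (Fin (m + 2))) a, A (fun s => a (σ s)) = A a)
    (i j : Fin n) (P : Fin m → Fin n) :
    A (Matrix.vecCons i (Matrix.vecCons j P)) = A (Matrix.vecCons j (Matrix.vecCons i P)) := by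
  rw [← hA (Equiv.swap 0 1)]
  congr 1
  funext s
  refine Fin.cases ?_ (fun s => Fin.cases ?_ (fun s => ?_) s) s
  · simp
  · have : (Fin.succ 0 : Fin (m + 2)) = 1 := rfl
    rw [this]; simp
  · rw [Equiv.swap_apply_of_ne_of_ne]
    · rfl
    · exact Fin.succ_ne_zero _
    · intro h
      exact Fin.succ_ne_zero s (Fin.succ_injective _ h)

theorem pairContr_trace_right {m : ℕ} {A : (Fin (m + 2) → Fin n) → ℝ}
    (htr : ∀ P : Fin m → Fin n,
      ∑ p, ∑ q, g p q * A (Matrix.vecCons p (Matrix.vecCons q P)) = 0) (i j : Fin n) :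
    ∑ p, ∑ q, g p q * pairContr g A A i j p q = 0 := by
  unfold pairContr
  simp only [← contr_sum_right]
  -- The weights `g p q` sit in the inner sum, so the outer one is pulled in with coefficient 1.
  have := contr_sum_right (g := g) Finset.univ (fun _ => (1 : ℝ))
    (fun P : Fin m → Fin n => A (Matrix.vecCons i (Matrix.vecCons j P)))
    (fun p P => ∑ q, g p q * A (Matrix.vecCons p (Matrix.vecCons q P)))
  simp only [one_mul, htr] at this
  rw [← this]
  exact contr_zero_right _

theorem pairContr_comm (hg : ∀ i j, g i j = g j i) {m : ℕ} (A : (Fin (m + 2) → Fin n) → ℝ)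
    (i j k l : Fin n) : pairContr g A A i j k l = pairContr g A A k l i j :=
  contr_comm hg _ _

theorem pairContr_swap_left {m : ℕ} {A : (Fin (m + 2) → Fin n) → ℝ}
    (hA : ∀ (σ : Equiv.Perm (Fin (m + 2))) a, A (fun s => a (σ s)) = A a) (i j k l : Fin n) :
    pairContr g A A i j k l = pairContr g A A j i k l := by
  unfold pairContr
  simp_rw [swap_vecCons hA i j]

theorem pairContr_swap_right {m : ℕ} {A : (Fin (m + 2) → Fin n) → ℝ}
    (hA : ∀ (σ : Equiv.Perm (Fin (m + 2))) a, A (fun s => a (σ s)) = A a) (i j k l : Fin n) :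
    pairContr g A A i j k l = pairContr g A A i j l k := by
  unfold pairContr
  simp_rw [swap_vecCons hA k l]

/-- By symmetry of `A` the four terms of `kwedge` merge into two. One contracts `A` with itself in
all slots but one; the other contains a trace of `A` and vanishes. -/
theorem ricTr_kwedge_self (hg : ∀ i j, g i j = g j i) {m : ℕ} {A : (Fin (m + 2) → Fin n) → ℝ}
    (hA : ∀ (σ : Equiv.Perm (Fin (m + 2))) a, A (fun s => a (σ s)) = A a)
    (htr : ∀ P : Fin m → Fin n,
      ∑ p, ∑ q, g p q * A (Matrix.vecCons p (Matrix.vecCons q P)) = 0) (i j : Fin n) :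
    ricTr g (kwedge g A A) i j = contrTail g A i j := by
  have hS : ∑ p, ∑ q, g p q * pairContr g A A p j q i = contrTail g A i j := by
    rw [contrTail_comm hg]
    unfold contrTail
    rw [contr_succ]
    simp only [pairContr, swap_vecCons hA _ i, swap_vecCons hA _ j]
  have hk : ∀ p q, kwedge g A A p i j q =
      pairContr g A A p j q i - pairContr g A A i j p q := by
    intro p q
    unfold kwedge
    rw [pairContr_swap_left hA j p i q, pairContr_swap_right hA p j i q,
      pairContr_comm hg A q i p j, pairContr_comm hg A q p i j, pairContr_swap_right hA i j q p,
      pairContr_swap_left hA j i p q]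
    ring
  unfold ricTr
  simp only [hk, mul_sub, Finset.sum_sub_distrib]
  rw [hS, pairContr_trace_right htr, sub_zero]

theorem kwedge_antisymm_left {m : ℕ} (A : (Fin (m + 2) → Fin n) → ℝ) (i j k l : Fin n) :
    kwedge g A A i j k l = -kwedge g A A j i k l := by
  unfold kwedge; ring

theorem kwedge_antisymm_right {m : ℕ} (A : (Fin (m + 2) → Fin n) → ℝ) (i j k l : Fin n) :
    kwedge g A A i j k l = -kwedge g A A i j l k := by
  unfold kwedge; ring

/-- The `-n` is the full trace of the identity. The resulting negative sign compensates the minus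
sign in (1). -/
theorem ricTr_kwedge_metric {H : Matrix (Fin n) (Fin n) ℝ} (hH : ∀ i j, H i j = H j i)
    (hgH : g * H = 1) (i j : Fin n) :
    ricTr g (kwedge g (fun a : Fin (0 + 2) → Fin n => H (a 0) (a 1))
      (fun a : Fin (0 + 2) → Fin n => H (a 0) (a 1))) i j = (1 - (n : ℝ)) * H i j := by
  -- At rank two no index is contracted: the sum runs over the single empty tuple.
  have hpc : ∀ a b c d, pairContr g (fun a : Fin (0 + 2) → Fin n => H (a 0) (a 1))
      (fun a : Fin (0 + 2) → Fin n => H (a 0) (a 1)) a b c d = H a b * H c d := by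
    intro a b c d
    simp [pairContr, contr]
  have hgH' : ∀ a b, ∑ q, g a q * H q b = (1 : Matrix (Fin n) (Fin n) ℝ) a b := by
    intro a b; rw [← hgH, Matrix.mul_apply]
  unfold ricTr kwedge
  simp only [hpc]
  have h1 : ∀ p, ∑ q, g p q * ((1 / 2) * (H j p * H i q - H j i * H p q)
      - (1 / 2) * (H q p * H i j - H q i * H p j)) =
      H p j * (1 : Matrix (Fin n) (Fin n) ℝ) p i
        - H i j * (1 : Matrix (Fin n) (Fin n) ℝ) p p := by
    intro p
    rw [← hgH', ← hgH', Finset.mul_sum, Finset.mul_sum, ← Finset.sum_sub_distrib]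
    refine Finset.sum_congr rfl fun q _ => ?_
    rw [hH j p, hH i q, hH j i, hH p q]
    ring
  simp only [h1, Finset.sum_sub_distrib, Matrix.one_apply]
  simp
  ring

end Algebra

/-! ### Double Hodge duality in dimension three. -/

section DimensionThree

/-- The permutation symbol in dimension three. -/
def eps (i j k : Fin 3) : ℝ :=
  ![![![0, 0, 0], ![0, 0, 1], ![0, -1, 0]], ![![0, 0, -1], ![0, 0, 0], ![1, 0, 0]],
    ![![0, 1, 0], ![-1, 0, 0], ![0, 0, 0]]] i j k

/-- Hodge duality between 2-forms and vectors; the cyclic order of the entries fixes the signs. -/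
theorem antisymm_eq_eps {A : Fin 3 → Fin 3 → ℝ} (hA : ∀ i j, A i j = -A j i) (i j : Fin 3) :
    A i j = ∑ a, eps i j a * ![A 1 2, A 2 0, A 0 1] a := by
  have h0 : ∀ i, A i i = 0 := fun i => by linarith [hA i i]
  fin_cases i <;> fin_cases j <;>
    simp [Fin.sum_univ_three, eps, h0] <;> exact hA _ _

/-- For invertible `g` with inverse $h$, contracting two permutation symbols gives
$\mathrm{Ric}_{ij}=\det g\,(Z_{ji}-h_{ij}\,\mathrm{tr}Z)$, with trace $-2\det g\,\mathrm{tr}Z$.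
Solving for $Z$ yields the raised Einstein tensor, transposed because $Z$ need not be symmetric. In
this form the identity is polynomial in `g` and `Z`, hence checked by expansion. -/
theorem det_mul_eq_ricTr {g : Matrix (Fin 3) (Fin 3) ℝ} (hg : ∀ i j, g i j = g j i)
    (Z : Fin 3 → Fin 3 → ℝ) (a b : Fin 3) :
    g.det * Z a b =
      (∑ p, ∑ q, g a p * g q b *
        ricTr g (fun i j k l => ∑ a, ∑ b, eps i j a * eps k l b * Z a b) q p)
      - (1 / 2) * (∑ p, ∑ q, g p q *
        ricTr g (fun i j k l => ∑ a, ∑ b, eps i j a * eps k l b * Z a b) p q) * g a b := by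
  have h1 := hg 1 0
  have h2 := hg 2 0
  have h3 := hg 2 1
  have hr : ∀ q p, ricTr g (fun i j k l => ∑ a, ∑ b, eps i j a * eps k l b * Z a b) q p =
      ![![g 1 2 * Z 1 2 + g 1 2 * Z 2 1 - g 1 1 * Z 2 2 - g 2 2 * Z 1 1,
          g 0 1 * Z 2 2 - g 1 2 * Z 2 0 - g 0 2 * Z 1 2 + g 2 2 * Z 1 0,
          g 1 1 * Z 2 0 - g 0 1 * Z 2 1 + g 0 2 * Z 1 1 - g 1 2 * Z 1 0],
        ![g 0 1 * Z 2 2 - g 0 2 * Z 2 1 - g 1 2 * Z 0 2 + g 2 2 * Z 0 1,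
          g 0 2 * Z 2 0 + g 0 2 * Z 0 2 - g 0 0 * Z 2 2 - g 2 2 * Z 0 0,
          g 0 0 * Z 2 1 - g 0 1 * Z 2 0 - g 0 2 * Z 0 1 + g 1 2 * Z 0 0],
        ![g 0 2 * Z 1 1 - g 0 1 * Z 1 2 + g 1 1 * Z 0 2 - g 1 2 * Z 0 1,
          g 0 0 * Z 1 2 - g 0 2 * Z 1 0 - g 0 1 * Z 0 2 + g 1 2 * Z 0 0,
          g 0 1 * Z 1 0 + g 0 1 * Z 0 1 - g 0 0 * Z 1 1 - g 1 1 * Z 0 0]] q p := by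
    intro q p
    fin_cases q <;> fin_cases p <;>
      simp [Fin.sum_univ_three, eps, ricTr, h1, h2, h3]
    all_goals ring
  simp only [hr]
  clear hr
  simp only [Matrix.det_fin_three, Fin.sum_univ_three]
  fin_cases a <;> fin_cases b <;> simp [h1, h2, h3] <;> ring

/-- In dimension three a tensor antisymmetric in the first and in the last pair of indices vanishes
as soon as its Ricci trace does. -/
theorem eq_zero_of_ricTr_eq_zero {g : Matrix (Fin 3) (Fin 3) ℝ} (hg : ∀ i j, g i j = g j i)
    (hdet : g.det ≠ 0) {Y : Fin 3 → Fin 3 → Fin 3 → Fin 3 → ℝ}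
    (h12 : ∀ i j k l, Y i j k l = -Y j i k l) (h34 : ∀ i j k l, Y i j k l = -Y i j l k)
    (hric : ∀ i j, ricTr g Y i j = 0) (i j k l : Fin 3) : Y i j k l = 0 := by
  obtain ⟨Z, hZ⟩ : ∃ Z : Fin 3 → Fin 3 → ℝ,
      Y = fun i j k l => ∑ a, ∑ b, eps i j a * eps k l b * Z a b := by
    -- `Z a b` is `Y` on the cyclic pairs dual to `a` and `b`.
    refine ⟨fun a b => ![fun b => ![Y 1 2 1 2, Y 1 2 2 0, Y 1 2 0 1] b,
      fun b => ![Y 2 0 1 2, Y 2 0 2 0, Y 2 0 0 1] b,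
      fun b => ![Y 0 1 1 2, Y 0 1 2 0, Y 0 1 0 1] b] a b, ?_⟩
    funext i j k l
    rw [antisymm_eq_eps (A := fun i j => Y i j k l) (fun i j => h12 i j k l)]
    refine Finset.sum_congr rfl fun a _ => ?_
    simp only [mul_assoc]
    rw [← Finset.mul_sum]
    congr 1
    fin_cases a <;> exact antisymm_eq_eps (h34 _ _) k l
  have hZ0 : ∀ a b, Z a b = 0 := by
    intro a b
    have := det_mul_eq_ricTr hg Z a b
    rw [← hZ] at this
    simp only [hric, mul_zero, Finset.sum_const_zero, zero_mul, sub_zero] at this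
    exact (mul_eq_zero.mp this).resolve_left hdet
  rw [hZ]
  simp [hZ0]

end DimensionThree

/-! ### Coordinate partial derivatives. -/

section PartialDerivatives

variable {n : ℕ} {f f' : EuclideanSpace ℝ (Fin n) → ℝ} {u : EuclideanSpace ℝ (Fin n)}
  {U : Set (EuclideanSpace ℝ (Fin n))}

theorem pd_congr (i : Fin n) (h : f =ᶠ[𝓝 u] f') : pd i f u = pd i f' u := by
  unfold pd; rw [h.fderiv_eq]

theorem pd_const (i : Fin n) (c : ℝ) : pd i (fun _ => c) u = 0 := by
  simp [pd]

theorem pd_add (i : Fin n) (hf : DifferentiableAt ℝ f u) (hf' : DifferentiableAt ℝ f' u) :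
    pd i (fun v => f v + f' v) u = pd i f u + pd i f' u := by
  unfold pd; rw [fderiv_fun_add hf hf']; rfl

theorem pd_sub (i : Fin n) (hf : DifferentiableAt ℝ f u) (hf' : DifferentiableAt ℝ f' u) :
    pd i (fun v => f v - f' v) u = pd i f u - pd i f' u := by
  unfold pd; rw [fderiv_fun_sub hf hf']; rfl

theorem pd_mul (i : Fin n) (hf : DifferentiableAt ℝ f u) (hf' : DifferentiableAt ℝ f' u) :
    pd i (fun v => f v * f' v) u = pd i f u * f' u + f u * pd i f' u := by
  unfold pd; rw [fderiv_fun_mul hf hf']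
  simp only [add_apply, smul_apply, smul_eq_mul]
  ring

theorem pd_sum (i : Fin n) {ι : Type*} (s : Finset ι) {F : ι → EuclideanSpace ℝ (Fin n) → ℝ}
    (hF : ∀ j ∈ s, DifferentiableAt ℝ (F j) u) :
    pd i (fun v => ∑ j ∈ s, F j v) u = ∑ j ∈ s, pd i (F j) u := by
  unfold pd; rw [fderiv_fun_sum hF]; simp

theorem pd_prod (i : Fin n) {ι : Type*} [DecidableEq ι] (s : Finset ι)
    {F : ι → EuclideanSpace ℝ (Fin n) → ℝ} (hF : ∀ j ∈ s, DifferentiableAt ℝ (F j) u) :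
    pd i (fun v => ∏ j ∈ s, F j v) u =
      ∑ j ∈ s, (∏ k ∈ s.erase j, F k u) * pd i (F j) u := by
  unfold pd
  rw [(HasFDerivAt.finsetProd fun j hj => (hF j hj).hasFDerivAt).fderiv]
  simp

theorem pd_comm (hU : IsOpen U) (hf : ContDiffOn ℝ ∞ f U) (hu : u ∈ U) (i j : Fin n) :
    pd i (pd j f) u = pd j (pd i f) u := by
  have hc := hf.contDiffAt (hU.mem_nhds hu)
  have hd : DifferentiableAt ℝ (fderiv ℝ f) u :=
    (hc.fderiv_right (m := 1) (by norm_cast)).differentiableAt (by norm_num)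
  have hs := hc.isSymmSndFDerivAt (by simpa using WithTop.coe_le_coe.2 (le_top : (2 : ℕ∞) ≤ ⊤))
  have key : ∀ a b : Fin n, pd a (pd b f) u =
      fderiv ℝ (fderiv ℝ f) u (EuclideanSpace.single a 1) (EuclideanSpace.single b 1) := by
    intro a b
    unfold pd
    rw [fderiv_clm_apply hd (differentiableAt_const _)]
    simp
  rw [key, key, hs.eq]

theorem contDiffOn_pd (hU : IsOpen U) (hf : ContDiffOn ℝ ∞ f U) (i : Fin n) :
    ContDiffOn ℝ ∞ (pd i f) U :=
  (hf.fderiv_of_isOpen hU (by norm_cast)).clm_apply contDiffOn_const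

theorem differentiableAt_of_smooth (hU : IsOpen U) (hf : ContDiffOn ℝ ∞ f U) (hu : u ∈ U) :
    DifferentiableAt ℝ f u :=
  (hf.contDiffAt (hU.mem_nhds hu)).differentiableAt (by norm_num)

end PartialDerivatives

/-! ### Calculus of matrix-valued functions. -/

section MatrixFunctions

variable {n : ℕ}

/-- Entrywise partial derivative of a matrix-valued function. -/
def mpd (i : Fin n) (F : EuclideanSpace ℝ (Fin n) → Matrix (Fin n) (Fin n) ℝ)
    (u : EuclideanSpace ℝ (Fin n)) : Matrix (Fin n) (Fin n) ℝ :=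
  Matrix.of fun a b => pd i (fun v => F v a b) u

/-- Entrywise smoothness of a matrix-valued function. -/
def MSmooth (F : EuclideanSpace ℝ (Fin n) → Matrix (Fin n) (Fin n) ℝ)
    (U : Set (EuclideanSpace ℝ (Fin n))) : Prop :=
  ∀ a b, ContDiffOn ℝ ∞ (fun v => F v a b) U

variable {F G : EuclideanSpace ℝ (Fin n) → Matrix (Fin n) (Fin n) ℝ}
  {u : EuclideanSpace ℝ (Fin n)} {U : Set (EuclideanSpace ℝ (Fin n))}

theorem MSmooth.add (hF : MSmooth F U) (hG : MSmooth G U) : MSmooth (fun v => F v + G v) U :=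
  fun a b => (hF a b).add (hG a b)

theorem MSmooth.sub (hF : MSmooth F U) (hG : MSmooth G U) : MSmooth (fun v => F v - G v) U :=
  fun a b => (hF a b).sub (hG a b)

theorem MSmooth.mul (hF : MSmooth F U) (hG : MSmooth G U) : MSmooth (fun v => F v * G v) U := by
  intro a b
  simp only [Matrix.mul_apply]
  exact ContDiffOn.sum fun c _ => (hF a c).mul (hG c b)

theorem MSmooth.transpose (hF : MSmooth F U) : MSmooth (fun v => (F v)ᵀ) U :=
  fun a b => hF b a

theorem MSmooth.mpd (hU : IsOpen U) (hF : MSmooth F U) (i : Fin n) :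
    MSmooth (EinsteinTensor.mpd i F) U :=
  fun a b => contDiffOn_pd hU (hF a b) i

theorem MSmooth.differentiableAt (hU : IsOpen U) (hF : MSmooth F U) (hu : u ∈ U) (a b : Fin n) :
    DifferentiableAt ℝ (fun v => F v a b) u :=
  differentiableAt_of_smooth hU (hF a b) hu

theorem contDiffOn_det {k : ℕ} {F : EuclideanSpace ℝ (Fin n) → Matrix (Fin k) (Fin k) ℝ}
    (hF : ∀ a b, ContDiffOn ℝ ∞ (fun v => F v a b) U) : ContDiffOn ℝ ∞ (fun v => (F v).det) U := by
  simp only [Matrix.det_apply']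
  exact ContDiffOn.sum fun σ _ => contDiffOn_const.mul (contDiffOn_prod fun i _ => hF _ _)

/-- Cramer's rule: the entries are cofactor determinants divided by a nonvanishing determinant. -/
theorem MSmooth.inv (hF : MSmooth F U) (hdet : ∀ v ∈ U, (F v).det ≠ 0) :
    MSmooth (fun v => (F v)⁻¹) U := by
  intro a b
  simp only [Matrix.inv_def, Ring.inverse_eq_inv', Matrix.smul_apply, smul_eq_mul,
    Matrix.adjugate_apply]
  refine (((contDiffOn_det hF).inv hdet)).mul (contDiffOn_det fun c d => ?_)
  by_cases hc : c = b
  · subst hc; simp only [Matrix.updateRow_self]; exact contDiffOn_const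
  · simp only [Matrix.updateRow_ne hc]; exact hF c d

theorem mpd_congr (i : Fin n) (h : ∀ᶠ v in 𝓝 u, F v = G v) : mpd i F u = mpd i G u := by
  ext a b
  exact pd_congr i (h.mono fun v hv => by simp only [hv])

theorem mpd_add (hU : IsOpen U) (hF : MSmooth F U) (hG : MSmooth G U) (hu : u ∈ U) (i : Fin n) :
    mpd i (fun v => F v + G v) u = mpd i F u + mpd i G u := by
  ext a b
  exact pd_add i (hF.differentiableAt hU hu a b) (hG.differentiableAt hU hu a b)

theorem mpd_sub (hU : IsOpen U) (hF : MSmooth F U) (hG : MSmooth G U) (hu : u ∈ U) (i : Fin n) :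
    mpd i (fun v => F v - G v) u = mpd i F u - mpd i G u := by
  ext a b
  exact pd_sub i (hF.differentiableAt hU hu a b) (hG.differentiableAt hU hu a b)

theorem mpd_mul (hU : IsOpen U) (hF : MSmooth F U) (hG : MSmooth G U) (hu : u ∈ U) (i : Fin n) :
    mpd i (fun v => F v * G v) u = mpd i F u * G u + F u * mpd i G u := by
  ext a b
  simp only [mpd, Matrix.of_apply, Matrix.add_apply, Matrix.mul_apply]
  rw [pd_sum i _ fun c _ => (hF.differentiableAt hU hu a c).fun_mul (hG.differentiableAt hU hu c b),
    ← Finset.sum_add_distrib]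
  exact Finset.sum_congr rfl fun c _ =>
    pd_mul i (hF.differentiableAt hU hu a c) (hG.differentiableAt hU hu c b)

theorem mpd_transpose (i : Fin n) : mpd i (fun v => (F v)ᵀ) u = (mpd i F u)ᵀ := rfl

theorem mpd_comm (hU : IsOpen U) (hF : MSmooth F U) (hu : u ∈ U) (i j : Fin n) :
    mpd i (mpd j F) u = mpd j (mpd i F) u := by
  ext a b
  exact pd_comm hU (hF a b) hu i j

theorem mpd_const (i : Fin n) (A : Matrix (Fin n) (Fin n) ℝ) : mpd i (fun _ => A) u = 0 := by
  ext a b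
  exact pd_const i _

end MatrixFunctions

/-! ### Curvature of connection matrices and the Bianchi identity. -/

section Connection

variable {n : ℕ} {Γ : Fin n → EuclideanSpace ℝ (Fin n) → Matrix (Fin n) (Fin n) ℝ}
  {H G : EuclideanSpace ℝ (Fin n) → Matrix (Fin n) (Fin n) ℝ}
  {u : EuclideanSpace ℝ (Fin n)} {U : Set (EuclideanSpace ℝ (Fin n))}

/-- Curvature `∂_i Γ_j - ∂_j Γ_i + [Γ_i, Γ_j]` of the connection matrices `Γ_i`. -/
def curv (Γ : Fin n → EuclideanSpace ℝ (Fin n) → Matrix (Fin n) (Fin n) ℝ) (i j : Fin n)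
    (u : EuclideanSpace ℝ (Fin n)) : Matrix (Fin n) (Fin n) ℝ :=
  mpd i (Γ j) u - mpd j (Γ i) u + (Γ i u * Γ j u - Γ j u * Γ i u)

theorem curv_antisymm (i j : Fin n) : curv Γ i j u = -curv Γ j i u := by
  unfold curv; abel

theorem curv_smooth (hU : IsOpen U) (hΓ : ∀ i, MSmooth (Γ i) U) (i j : Fin n) :
    MSmooth (curv Γ i j) U :=
  (((hΓ j).mpd hU i).sub ((hΓ i).mpd hU j)).add (((hΓ i).mul (hΓ j)).sub ((hΓ j).mul (hΓ i)))

theorem mpd_curv (hU : IsOpen U) (hΓ : ∀ i, MSmooth (Γ i) U) (hu : u ∈ U) (a i j : Fin n) :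
    mpd a (curv Γ i j) u = mpd a (mpd i (Γ j)) u - mpd a (mpd j (Γ i)) u
      + ((mpd a (Γ i) u * Γ j u + Γ i u * mpd a (Γ j) u)
        - (mpd a (Γ j) u * Γ i u + Γ j u * mpd a (Γ i) u)) := by
  have h1 := ((hΓ j).mpd hU i)
  have h2 := ((hΓ i).mpd hU j)
  have h3 := ((hΓ i).mul (hΓ j))
  have h4 := ((hΓ j).mul (hΓ i))
  unfold curv
  rw [mpd_add hU (h1.sub h2) (h3.sub h4) hu, mpd_sub hU h1 h2 hu, mpd_sub hU h3 h4 hu,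
    mpd_mul hU (hΓ i) (hΓ j) hu, mpd_mul hU (hΓ j) (hΓ i) hu]

/-- The differential Bianchi identity. -/
theorem bianchi (hU : IsOpen U) (hΓ : ∀ i, MSmooth (Γ i) U) (hu : u ∈ U) (a b c : Fin n) :
    (mpd a (curv Γ b c) u + (Γ a u * curv Γ b c u - curv Γ b c u * Γ a u))
      + (mpd b (curv Γ c a) u + (Γ b u * curv Γ c a u - curv Γ c a u * Γ b u))
      + (mpd c (curv Γ a b) u + (Γ c u * curv Γ a b u - curv Γ a b u * Γ c u)) = 0 := by
  -- Once mixed second derivatives commute, only the Leibniz rule and the Jacobi identity for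
  -- commutators remain.
  rw [mpd_curv hU hΓ hu, mpd_curv hU hΓ hu, mpd_curv hU hΓ hu,
    mpd_comm hU (hΓ c) hu a b, mpd_comm hU (hΓ b) hu a c, mpd_comm hU (hΓ a) hu b c]
  unfold curv
  noncomm_ring

/-- Differentiating `H * G = 1` turns parallelism of the metric into parallelism of its inverse. -/
theorem mpd_inv (hU : IsOpen U) (hH : MSmooth H U) (hG : MSmooth G U)
    (hHG : ∀ v ∈ U, H v * G v = 1) (hu : u ∈ U) (i : Fin n)
    (hcomp : mpd i H u = (Γ i u)ᵀ * H u + H u * Γ i u) :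
    mpd i G u = -(Γ i u * G u) - G u * (Γ i u)ᵀ := by
  have h1 : mpd i (fun v => H v * G v) u = 0 := by
    rw [mpd_congr i (G := fun _ => 1) (Filter.Eventually.mono (hU.mem_nhds hu) hHG), mpd_const]
  rw [mpd_mul hU hH hG hu, hcomp] at h1
  have hGH : G u * H u = 1 := mul_eq_one_comm.mp (hHG u hu)
  have h2 : mpd i G u = G u * (H u * mpd i G u) := by rw [← mul_assoc, hGH, one_mul]
  have h3 : H u * mpd i G u = -(((Γ i u)ᵀ * H u + H u * Γ i u) * G u) :=
    eq_neg_of_add_eq_zero_right h1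
  rw [h2, h3, add_mul, mul_assoc, hHG u hu, mul_neg, mul_add, mul_assoc (H u),
    ← mul_assoc (G u) (H u), hGH]
  noncomm_ring

/-- Expanding the two mixed second derivatives of `H` by metric compatibility, their difference is
exactly this expression. -/
theorem curv_metric_antisymm (hU : IsOpen U) (hΓ : ∀ i, MSmooth (Γ i) U) (hH : MSmooth H U)
    (hcomp : ∀ v ∈ U, ∀ i, mpd i H v = (Γ i v)ᵀ * H v + H v * Γ i v) (hu : u ∈ U) (i j : Fin n) :
    (curv Γ i j u)ᵀ * H u + H u * curv Γ i j u = 0 := by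
  have hn : ∀ᶠ v in 𝓝 u, v ∈ U := hU.mem_nhds hu
  have key : ∀ a b, mpd a (mpd b H) u =
      (mpd a (Γ b) u)ᵀ * H u + (Γ b u)ᵀ * ((Γ a u)ᵀ * H u + H u * Γ a u)
        + (((Γ a u)ᵀ * H u + H u * Γ a u) * Γ b u + H u * mpd a (Γ b) u) := by
    intro a b
    rw [mpd_congr a (hn.mono fun v hv => hcomp v hv b),
      mpd_add hU ((hΓ b).transpose.mul hH) (hH.mul (hΓ b)) hu,
      mpd_mul hU (hΓ b).transpose hH hu, mpd_mul hU hH (hΓ b) hu, mpd_transpose, hcomp u hu a]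
  have h := mpd_comm hU hH hu i j
  rw [key, key, ← sub_eq_zero] at h
  rw [← h]
  simp only [curv, Matrix.transpose_add, Matrix.transpose_sub, Matrix.transpose_mul]
  noncomm_ring

theorem curv_inv_antisymm {R H G : Matrix (Fin n) (Fin n) ℝ} (hHG : H * G = 1)
    (hR : Rᵀ * H + H * R = 0) : R * G + G * Rᵀ = 0 := by
  have hGH : G * H = 1 := mul_eq_one_comm.mp hHG
  have : G * (Rᵀ * H + H * R) * G = 0 := by rw [hR]; simp
  rw [mul_add, add_mul, mul_assoc, mul_assoc, hHG, ← mul_assoc G H, hGH] at this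
  simpa [add_comm] using this

/-- Full covariant derivative of the curvature. -/
def covCurv (Γ : Fin n → EuclideanSpace ℝ (Fin n) → Matrix (Fin n) (Fin n) ℝ) (a b c : Fin n)
    (u : EuclideanSpace ℝ (Fin n)) : Matrix (Fin n) (Fin n) ℝ :=
  mpd a (curv Γ b c) u + (Γ a u * curv Γ b c u - curv Γ b c u * Γ a u)
    - ∑ p, Γ a u p b • curv Γ p c u - ∑ p, Γ a u p c • curv Γ b p u

/-- Torsion-freeness makes the Christoffel corrections on the form indices cancel in pairs across
the cyclic sum, which reduces to `bianchi`. -/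
theorem covCurv_cyclic (hU : IsOpen U) (hΓ : ∀ i, MSmooth (Γ i) U)
    (hsymm : ∀ a b p, Γ a u p b = Γ b u p a) (hu : u ∈ U) (a b c : Fin n) :
    covCurv Γ a b c u + covCurv Γ b c a u + covCurv Γ c a b u = 0 := by
  have h := bianchi hU hΓ hu a b c
  have e : ∀ x y z : Fin n, ∑ p, Γ x u p y • curv Γ z p u = -∑ p, Γ y u p x • curv Γ p z u := by
    intro x y z
    rw [← Finset.sum_neg_distrib]
    refine Finset.sum_congr rfl fun p _ => ?_
    rw [hsymm x y p, curv_antisymm z p, smul_neg]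
  unfold covCurv
  rw [e a c b, e b a c, e c b a, ← h]
  abel

/-- The inverse metric is parallel, so covariant differentiation preserves skewness of the raised
curvature. -/
theorem covCurv_inv_antisymm (hU : IsOpen U) (hΓ : ∀ i, MSmooth (Γ i) U) (hG : MSmooth G U)
    (hdG : ∀ i, mpd i G u = -(Γ i u * G u) - G u * (Γ i u)ᵀ)
    (hR : ∀ v ∈ U, ∀ i j, curv Γ i j v * G v + G v * (curv Γ i j v)ᵀ = 0) (hu : u ∈ U)
    (a b c : Fin n) : covCurv Γ a b c u * G u + G u * (covCurv Γ a b c u)ᵀ = 0 := by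
  have hs := curv_smooth hU hΓ b c
  have h1 : mpd a (fun v => curv Γ b c v * G v + G v * (curv Γ b c v)ᵀ) u = 0 := by
    rw [mpd_congr a (G := fun _ => 0)
      (Filter.Eventually.mono (hU.mem_nhds hu) fun v hv => hR v hv b c), mpd_const]
  rw [mpd_add hU (hs.mul hG) (hG.mul hs.transpose) hu, mpd_mul hU hs hG hu,
    mpd_mul hU hG hs.transpose hu, mpd_transpose, hdG] at h1
  have h2 := hR u hu b c
  have h3 : ∀ p, (Γ a u p b • curv Γ p c u) * G u + G u * (Γ a u p b • curv Γ p c u)ᵀ = 0 := by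
    intro p
    rw [Matrix.transpose_smul, smul_mul_assoc, mul_smul_comm, ← smul_add, hR u hu, smul_zero]
  have h4 : ∀ p, (Γ a u p c • curv Γ b p u) * G u + G u * (Γ a u p c • curv Γ b p u)ᵀ = 0 := by
    intro p
    rw [Matrix.transpose_smul, smul_mul_assoc, mul_smul_comm, ← smul_add, hR u hu, smul_zero]
  have h5 : (∑ p, Γ a u p b • curv Γ p c u) * G u + G u * (∑ p, Γ a u p b • curv Γ p c u)ᵀ = 0 := by
    rw [Matrix.transpose_sum, Finset.sum_mul, Finset.mul_sum, ← Finset.sum_add_distrib]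
    exact Finset.sum_eq_zero fun p _ => h3 p
  have h6 : (∑ p, Γ a u p c • curv Γ b p u) * G u + G u * (∑ p, Γ a u p c • curv Γ b p u)ᵀ = 0 := by
    rw [Matrix.transpose_sum, Finset.sum_mul, Finset.mul_sum, ← Finset.sum_add_distrib]
    exact Finset.sum_eq_zero fun p _ => h4 p
  unfold covCurv
  set X := ∑ p, Γ a u p b • curv Γ p c u
  set Y := ∑ p, Γ a u p c • curv Γ b p u
  set R := curv Γ b c u
  set D := mpd a (curv Γ b c) u
  simp only [Matrix.transpose_add, Matrix.transpose_sub, Matrix.transpose_mul]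
  calc _ = (D * G u + R * (-(Γ a u * G u) - G u * (Γ a u)ᵀ)
          + ((-(Γ a u * G u) - G u * (Γ a u)ᵀ) * Rᵀ + G u * Dᵀ))
        + (R * G u + G u * Rᵀ) * (Γ a u)ᵀ + Γ a u * (R * G u + G u * Rᵀ)
        - (X * G u + G u * Xᵀ) - (Y * G u + G u * Yᵀ) := by noncomm_ring
    _ = 0 := by rw [h1, h2, h5, h6]; simp

end Connection

/-! ### Rank-two tensors and the contracted Bianchi identity. -/

section Connection

variable {n : ℕ} {Γ : Fin n → EuclideanSpace ℝ (Fin n) → Matrix (Fin n) (Fin n) ℝ}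
  {H G F : EuclideanSpace ℝ (Fin n) → Matrix (Fin n) (Fin n) ℝ}
  {u : EuclideanSpace ℝ (Fin n)} {U : Set (EuclideanSpace ℝ (Fin n))}

/-- Covariant derivative of a covariant tensor of rank two. -/
def covMat (Γ : Fin n → EuclideanSpace ℝ (Fin n) → Matrix (Fin n) (Fin n) ℝ) (a : Fin n)
    (F : EuclideanSpace ℝ (Fin n) → Matrix (Fin n) (Fin n) ℝ) (u : EuclideanSpace ℝ (Fin n)) :
    Matrix (Fin n) (Fin n) ℝ :=
  mpd a F u - (Γ a u)ᵀ * F u - F u * Γ a u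

/-- Divergence of a covariant tensor of rank two in its second index. -/
def divMat (Γ : Fin n → EuclideanSpace ℝ (Fin n) → Matrix (Fin n) (Fin n) ℝ)
    (G F : EuclideanSpace ℝ (Fin n) → Matrix (Fin n) (Fin n) ℝ) (a : Fin n)
    (u : EuclideanSpace ℝ (Fin n)) : ℝ :=
  ∑ c, ∑ k, G u c k * covMat Γ c F u a k

/-- The inverse metric is parallel, so only the tensor is differentiated. Cyclicity of the matrix
trace matches the correction terms. -/
theorem pd_trace (hU : IsOpen U) (hG : MSmooth G U) (hF : MSmooth F U) (hu : u ∈ U)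
    (a : Fin n) (hdG : mpd a G u = -(Γ a u * G u) - G u * (Γ a u)ᵀ) :
    pd a (fun v => ∑ i, ∑ j, G v i j * F v i j) u =
      ∑ i, ∑ j, G u i j * covMat Γ a F u i j := by
  have tr : ∀ A B : Matrix (Fin n) (Fin n) ℝ, ∑ i, ∑ j, A i j * B i j = (A * Bᵀ).trace := by
    intro A B
    simp [Matrix.trace, Matrix.mul_apply]
  have hs : ∀ i j, DifferentiableAt ℝ (fun v => G v i j * F v i j) u := fun i j =>
    (hG.differentiableAt hU hu i j).fun_mul (hF.differentiableAt hU hu i j)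
  rw [pd_sum a _ fun i _ => DifferentiableAt.fun_sum fun j _ => hs i j]
  have h1 : ∀ i, pd a (fun v => ∑ j, G v i j * F v i j) u =
      ∑ j, (mpd a G u i j * F u i j + G u i j * mpd a F u i j) := by
    intro i
    rw [pd_sum a _ fun j _ => hs i j]
    exact Finset.sum_congr rfl fun j _ =>
      pd_mul a (hG.differentiableAt hU hu i j) (hF.differentiableAt hU hu i j)
  simp only [h1, Finset.sum_add_distrib]
  rw [tr, tr, tr, hdG, covMat]
  simp only [Matrix.transpose_sub, Matrix.transpose_mul, Matrix.transpose_transpose, sub_mul,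
    mul_sub, neg_mul, Matrix.trace_sub, Matrix.trace_neg]
  have e1 : (Γ a u * G u * (F u)ᵀ).trace = (G u * ((F u)ᵀ * Γ a u)).trace := by
    rw [mul_assoc, Matrix.trace_mul_comm, mul_assoc]
  rw [e1, mul_assoc]
  ring

theorem covMat_smul_metric {f : EuclideanSpace ℝ (Fin n) → ℝ} (hU : IsOpen U)
    (hf : ContDiffOn ℝ ∞ f U) (hH : MSmooth H U) (hu : u ∈ U) (a : Fin n)
    (hcomp : mpd a H u = (Γ a u)ᵀ * H u + H u * Γ a u) :
    covMat Γ a (fun v => f v • H v) u = pd a f u • H u := by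
  have h1 : mpd a (fun v => f v • H v) u = pd a f u • H u + f u • mpd a H u := by
    ext i j
    exact pd_mul a (differentiableAt_of_smooth hU hf hu) (hH.differentiableAt hU hu i j)
  unfold covMat
  rw [h1, hcomp]
  simp only [smul_add, mul_smul_comm, smul_mul_assoc]
  abel

theorem covMat_add {F' : EuclideanSpace ℝ (Fin n) → Matrix (Fin n) (Fin n) ℝ} (hU : IsOpen U)
    (hF : MSmooth F U) (hF' : MSmooth F' U) (hu : u ∈ U) (a : Fin n) :
    covMat Γ a (fun v => F v + F' v) u = covMat Γ a F u + covMat Γ a F' u := by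
  unfold covMat
  rw [mpd_add hU hF hF' hu]
  noncomm_ring

theorem covMat_const_smul (hU : IsOpen U) (hF : MSmooth F U) (hu : u ∈ U) (a : Fin n) (c : ℝ) :
    covMat Γ a (fun v => c • F v) u = c • covMat Γ a F u := by
  have h1 : mpd a (fun v => c • F v) u = c • mpd a F u := by
    ext i j
    have := pd_mul a (differentiableAt_const c) (hF.differentiableAt hU hu i j)
    rw [pd_const, zero_mul, zero_add] at this
    exact this
  unfold covMat
  rw [h1]
  simp only [smul_sub, mul_smul_comm, smul_mul_assoc]

/-- Ricci contraction of the curvature of a linear connection. -/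
def ricMat (Γ : Fin n → EuclideanSpace ℝ (Fin n) → Matrix (Fin n) (Fin n) ℝ)
    (u : EuclideanSpace ℝ (Fin n)) : Matrix (Fin n) (Fin n) ℝ :=
  Matrix.of fun c k => ∑ b, curv Γ b c u b k

theorem ricMat_smooth (hU : IsOpen U) (hΓ : ∀ i, MSmooth (Γ i) U) : MSmooth (ricMat Γ) U :=
  fun c k => ContDiffOn.sum (f := fun b v => curv Γ b c v b k) (s := Finset.univ)
    fun b _ => curv_smooth hU hΓ b c b k

theorem covMat_ricMat (hU : IsOpen U) (hΓ : ∀ i, MSmooth (Γ i) U) (hu : u ∈ U) (a c k : Fin n) :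
    ∑ b, covCurv Γ a b c u b k = covMat Γ a (ricMat Γ) u c k := by
  have h1 : mpd a (ricMat Γ) u c k = ∑ b, mpd a (curv Γ b c) u b k :=
    pd_sum a Finset.univ (F := fun b v => curv Γ b c v b k)
      fun b _ => (curv_smooth hU hΓ b c).differentiableAt hU hu b k
  have h3 : ∑ b, ∑ p, curv Γ b c u b p * Γ a u p k = ∑ p, (∑ b, curv Γ b c u b p) * Γ a u p k := by
    rw [Finset.sum_comm]
    simp only [Finset.sum_mul]
  have h4 : ∑ b, ∑ p, Γ a u p c * curv Γ b p u b k = ∑ p, Γ a u p c * ∑ b, curv Γ b p u b k := by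
    rw [Finset.sum_comm]
    simp only [Finset.mul_sum]
  simp only [covCurv, covMat, Matrix.sub_apply, Matrix.add_apply, Matrix.sum_apply,
    Matrix.smul_apply, smul_eq_mul, Matrix.mul_apply, Finset.sum_sub_distrib,
    Finset.sum_add_distrib, Matrix.transpose_apply]
  rw [h1, h3, h4]
  simp only [ricMat, Matrix.of_apply]
  -- The corrections for the contracted upper and lower index cancel: covariant differentiation
  -- commutes with contraction.
  have h5 : ∑ b, ∑ p, Γ a u b p * curv Γ b c u p k - ∑ b, ∑ p, Γ a u p b * curv Γ p c u b k = 0 :=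
    sub_eq_zero.mpr Finset.sum_comm
  linarith

theorem covCurv_antisymm (hU : IsOpen U) (hΓ : ∀ i, MSmooth (Γ i) U) (hu : u ∈ U)
    (a b c : Fin n) : covCurv Γ a b c u = -covCurv Γ a c b u := by
  have h1 : mpd a (curv Γ b c) u = -mpd a (curv Γ c b) u := by
    rw [mpd_curv hU hΓ hu, mpd_curv hU hΓ hu]
    abel
  have e : ∀ x y : Fin n, ∑ p, Γ a u p x • curv Γ p y u = -∑ p, Γ a u p x • curv Γ y p u := by
    intro x y
    rw [← Finset.sum_neg_distrib]
    refine Finset.sum_congr rfl fun p _ => ?_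
    rw [curv_antisymm p y, smul_neg]
  unfold covCurv
  rw [h1, e, e, curv_antisymm b c]
  noncomm_ring

/-- The contracted differential Bianchi identity. -/
theorem contracted_bianchi (hU : IsOpen U) (hΓ : ∀ i, MSmooth (Γ i) U) (hG : MSmooth G U)
    (hsymm : ∀ a b p, Γ a u p b = Γ b u p a) (hGs : ∀ i j, G u i j = G u j i)
    (hdG : ∀ i, mpd i G u = -(Γ i u * G u) - G u * (Γ i u)ᵀ)
    (hR : ∀ v ∈ U, ∀ i j, curv Γ i j v * G v + G v * (curv Γ i j v)ᵀ = 0) (hu : u ∈ U)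
    (a : Fin n) :
    ∑ c, ∑ k, G u c k * covMat Γ a (ricMat Γ) u c k = 2 * divMat Γ G (ricMat Γ) a u := by
  -- The cyclic identity, contracted over `b` with the upper index.
  have h1 : ∀ c k, covMat Γ a (ricMat Γ) u c k =
      covMat Γ c (ricMat Γ) u a k - ∑ b, covCurv Γ b c a u b k := by
    intro c k
    rw [← covMat_ricMat hU hΓ hu, ← covMat_ricMat hU hΓ hu, ← Finset.sum_sub_distrib]
    refine Finset.sum_congr rfl fun b _ => ?_
    have := congrFun (congrFun (covCurv_cyclic hU hΓ hsymm hu a b c) b) k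
    rw [covCurv_antisymm hU hΓ hu c a b] at this
    simp only [Matrix.add_apply, Matrix.neg_apply, Matrix.zero_apply] at this
    linarith
  -- Skewness moves the contraction with the upper index from `b` to `c`. This produces a second
  -- copy of the divergence, whence the factor 2.
  have h2 : ∑ c, ∑ k, G u c k * ∑ b, covCurv Γ b c a u b k = -divMat Γ G (ricMat Γ) a u := by
    have e1 : ∑ c, ∑ k, G u c k * ∑ b, covCurv Γ b c a u b k =
        ∑ c, ∑ b, (covCurv Γ b c a u * G u) b c := by
      refine Finset.sum_congr rfl fun c _ => ?_
      simp only [Finset.mul_sum, Matrix.mul_apply]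
      rw [Finset.sum_comm]
      refine Finset.sum_congr rfl fun b _ => Finset.sum_congr rfl fun k _ => ?_
      rw [hGs c k, mul_comm]
    have e2 : ∀ b c, (covCurv Γ b c a u * G u) b c = -(G u * (covCurv Γ b c a u)ᵀ) b c := by
      intro b c
      rw [eq_neg_of_add_eq_zero_left (covCurv_inv_antisymm hU hΓ hG hdG hR hu b c a)]
      rfl
    rw [e1, Finset.sum_comm]
    simp only [e2, Finset.sum_neg_distrib]
    congr 1
    refine Finset.sum_congr rfl fun b _ => ?_
    simp only [Matrix.mul_apply, Matrix.transpose_apply]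
    rw [Finset.sum_comm]
    refine Finset.sum_congr rfl fun k _ => ?_
    rw [← Finset.mul_sum, covMat_ricMat hU hΓ hu]
  simp only [h1, mul_sub, Finset.sum_sub_distrib]
  rw [h2]
  unfold divMat
  ring

end Connection

/-! ### Leibniz rule for complete contractions. -/

section Contraction

variable {n : ℕ} {Γ : Fin n → EuclideanSpace ℝ (Fin n) → Matrix (Fin n) (Fin n) ℝ}
  {G : EuclideanSpace ℝ (Fin n) → Matrix (Fin n) (Fin n) ℝ}
  {u : EuclideanSpace ℝ (Fin n)} {U : Set (EuclideanSpace ℝ (Fin n))}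

/-- Covariant derivative of a component array. -/
def covArr (Γ : Fin n → EuclideanSpace ℝ (Fin n) → Matrix (Fin n) (Fin n) ℝ) {k : ℕ}
    (A : EuclideanSpace ℝ (Fin n) → (Fin k → Fin n) → ℝ) (u : EuclideanSpace ℝ (Fin n)) (i : Fin n)
    (a : Fin k → Fin n) : ℝ :=
  pd i (fun v => A v a) u - ∑ s, ∑ p, Γ i u p (a s) * A u (Function.update a s p)

/-- Exchanging the entry in slot `s` with the free index is an involution of the summation range. -/
theorem sum_update_comm {k : ℕ} (s : Fin k) (F : (Fin k → Fin n) → Fin n → ℝ) :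
    ∑ P, ∑ p, F P p = ∑ P : Fin k → Fin n, ∑ p, F (Function.update P s p) (P s) := by
  rw [← Fintype.sum_prod_type', ← Fintype.sum_prod_type']
  refine Finset.sum_bij' (fun x _ => (Function.update x.1 s x.2, x.1 s))
    (fun x _ => (Function.update x.1 s x.2, x.1 s)) ?_ ?_ ?_ ?_ ?_ <;> simp

theorem prod_erase_update {k : ℕ} (g : Matrix (Fin n) (Fin n) ℝ) (s : Fin k)
    (P Q : Fin k → Fin n) (p : Fin n) :
    (∏ t ∈ Finset.univ.erase s, g (Function.update P s p t) (Q t)) =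
      ∏ t ∈ Finset.univ.erase s, g (P t) (Q t) := by
  refine Finset.prod_congr rfl fun t ht => ?_
  rw [Function.update_of_ne (Finset.ne_of_mem_erase ht)]

/-- Moving an endomorphism acting on the inverse metric onto the left factor of a contraction. -/
theorem sum_contr_derivation {k : ℕ} (g M : Matrix (Fin n) (Fin n) ℝ)
    (A B : (Fin k → Fin n) → ℝ) :
    ∑ P : Fin k → Fin n, ∑ Q : Fin k → Fin n,
      (∑ s, (∏ t ∈ Finset.univ.erase s, g (P t) (Q t)) * (M * g) (P s) (Q s)) * A P * B Q =
    contr g (fun P => ∑ s, ∑ p, M p (P s) * A (Function.update P s p)) B := by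
  have h1 : ∀ Q : Fin k → Fin n, ∀ s : Fin k,
      ∑ P : Fin k → Fin n,
        (∏ t ∈ Finset.univ.erase s, g (P t) (Q t)) * (M * g) (P s) (Q s) * A P * B Q =
      ∑ P : Fin k → Fin n,
        (∏ t, g (P t) (Q t)) * (∑ p, M p (P s) * A (Function.update P s p)) * B Q := by
    intro Q s
    have e1 : ∀ P : Fin k → Fin n,
        (∏ t ∈ Finset.univ.erase s, g (P t) (Q t)) * (M * g) (P s) (Q s) * A P * B Q =
        ∑ p, (∏ t ∈ Finset.univ.erase s, g (P t) (Q t)) * (M (P s) p * g p (Q s)) * A P * B Q := by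
      intro P
      simp only [Matrix.mul_apply, Finset.mul_sum, Finset.sum_mul]
    simp only [e1]
    -- The exchange puts the dummy index into slot `s` of `A` and restores the missing factor `g (P
    -- s) (Q s)`.
    rw [sum_update_comm s]
    refine Finset.sum_congr rfl fun P _ => ?_
    rw [← Finset.mul_prod_erase Finset.univ (fun t => g (P t) (Q t)) (Finset.mem_univ s),
      Finset.mul_sum, Finset.sum_mul]
    refine Finset.sum_congr rfl fun p _ => ?_
    rw [prod_erase_update, Function.update_self]
    ring
  unfold contr
  rw [Finset.sum_comm]
  conv_rhs => rw [Finset.sum_comm]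
  refine Finset.sum_congr rfl fun Q _ => ?_
  simp only [Finset.sum_mul]
  rw [Finset.sum_comm]
  simp only [h1]
  rw [Finset.sum_comm]
  refine Finset.sum_congr rfl fun P _ => ?_
  rw [← Finset.sum_mul, ← Finset.mul_sum]

theorem sum_contr_derivation' {k : ℕ} (g M : Matrix (Fin n) (Fin n) ℝ)
    (A B : (Fin k → Fin n) → ℝ) :
    ∑ P : Fin k → Fin n, ∑ Q : Fin k → Fin n,
      (∑ s, (∏ t ∈ Finset.univ.erase s, g (P t) (Q t)) * (g * Mᵀ) (P s) (Q s)) * A P * B Q =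
    contr g A (fun P => ∑ s, ∑ p, M p (P s) * B (Function.update P s p)) := by
  rw [contr_transpose, ← sum_contr_derivation, Finset.sum_comm]
  refine Finset.sum_congr rfl fun P _ => Finset.sum_congr rfl fun Q _ => ?_
  rw [← Matrix.transpose_transpose M, ← Matrix.transpose_mul]
  simp only [Matrix.transpose_apply, Matrix.transpose_transpose]
  ring

/-- Each factor of the inverse metric differentiates into two terms, which supply the Christoffel
corrections of `A` and of `B`. -/
theorem pd_contr {k : ℕ} {A B : EuclideanSpace ℝ (Fin n) → (Fin k → Fin n) → ℝ} (hU : IsOpen U)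
    (hG : MSmooth G U) (hA : ∀ P, ContDiffOn ℝ ∞ (fun v => A v P) U)
    (hB : ∀ P, ContDiffOn ℝ ∞ (fun v => B v P) U) (hu : u ∈ U) (i : Fin n)
    (hdG : mpd i G u = -(Γ i u * G u) - G u * (Γ i u)ᵀ) :
    pd i (fun v => contr (G v) (A v) (B v)) u =
      contr (G u) (covArr Γ A u i) (B u) + contr (G u) (A u) (covArr Γ B u i) := by
  have dA := fun P => differentiableAt_of_smooth hU (hA P) hu
  have dB := fun P => differentiableAt_of_smooth hU (hB P) hu
  have dG := hG.differentiableAt hU hu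
  have dP : ∀ P Q : Fin k → Fin n, DifferentiableAt ℝ (fun v => ∏ s, G v (P s) (Q s)) u :=
    fun P Q => (HasFDerivAt.finsetProd (u := Finset.univ) (g := fun s v => G v (P s) (Q s))
      fun s _ => (dG (P s) (Q s)).hasFDerivAt).differentiableAt
  have h1 : ∀ P Q : Fin k → Fin n,
      pd i (fun v => (∏ s, G v (P s) (Q s)) * A v P * B v Q) u =
        (∏ s, G u (P s) (Q s)) * pd i (fun v => A v P) u * B u Q
        + (∏ s, G u (P s) (Q s)) * A u P * pd i (fun v => B v Q) u
        - (∑ s, (∏ t ∈ Finset.univ.erase s, G u (P t) (Q t)) * (Γ i u * G u) (P s) (Q s))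
          * A u P * B u Q
        - (∑ s, (∏ t ∈ Finset.univ.erase s, G u (P t) (Q t)) * (G u * (Γ i u)ᵀ) (P s) (Q s))
          * A u P * B u Q := by
    intro P Q
    have e : ∀ s, pd i (fun v => G v (P s) (Q s)) u =
        -(Γ i u * G u) (P s) (Q s) - (G u * (Γ i u)ᵀ) (P s) (Q s) := fun s =>
      congrFun (congrFun hdG (P s)) (Q s)
    rw [pd_mul i ((dP P Q).fun_mul (dA P)) (dB Q), pd_mul i (dP P Q) (dA P),
      pd_prod i Finset.univ fun s _ => dG _ _]
    simp only [e, mul_sub, mul_neg, Finset.sum_sub_distrib, Finset.sum_neg_distrib]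
    ring
  have h2 : pd i (fun v => contr (G v) (A v) (B v)) u =
      ∑ P, ∑ Q, pd i (fun v => (∏ s, G v (P s) (Q s)) * A v P * B v Q) u := by
    unfold contr
    have d : ∀ P Q, DifferentiableAt ℝ (fun v => (∏ s, G v (P s) (Q s)) * A v P * B v Q) u :=
      fun P Q => ((dP P Q).fun_mul (dA P)).fun_mul (dB Q)
    rw [pd_sum i _ fun P _ => DifferentiableAt.fun_sum fun Q _ => d P Q]
    exact Finset.sum_congr rfl fun P _ => pd_sum i _ fun Q _ => d P Q
  have h3 : contr (G u) (covArr Γ A u i) (B u) = contr (G u) (fun P => pd i (fun v => A v P) u) (B u)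
      - contr (G u) (fun P => ∑ s, ∑ p, Γ i u p (P s) * A u (Function.update P s p)) (B u) :=
    contr_sub_left _ _ _
  have h4 : contr (G u) (A u) (covArr Γ B u i) = contr (G u) (A u) (fun P => pd i (fun v => B v P) u)
      - contr (G u) (A u) (fun P => ∑ s, ∑ p, Γ i u p (P s) * B u (Function.update P s p)) := by
    simp only [contr_transpose (G u) (A u)]
    exact contr_sub_left _ _ _
  rw [h2, h3, h4, ← sum_contr_derivation, ← sum_contr_derivation']
  simp only [h1, Finset.sum_sub_distrib, Finset.sum_add_distrib]
  unfold contr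
  ring

end Contraction

/-! ### The Levi-Civita connection of the metric in a chart. -/

section Geometry

variable {n : ℕ} {M : Type*} [TopologicalSpace M] [ChartedSpace (EuclideanSpace ℝ (Fin n)) M]
  {h : PseudoRiemannianMetric n M} {e : OpenPartialHomeomorph M (EuclideanSpace ℝ (Fin n))}
  {u : EuclideanSpace ℝ (Fin n)}

theorem metric_symm (i j : Fin n) : metric h e u i j = metric h e u j i :=
  h.symm _ _ _

theorem mdifferentiable_of_mem_maximalAtlas (he : e ∈ IsManifold.maximalAtlas (𝓡 n) ∞ M) :
    e.MDifferentiable (𝓡 n) (𝓡 n) :=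
  ⟨(contMDiffOn_of_mem_maximalAtlas he).mdifferentiableOn (by simp),
    (contMDiffOn_symm_of_mem_maximalAtlas he).mdifferentiableOn (by simp)⟩

/-- The coordinate vectors form a basis because the differential of the inverse chart is bijective.
A kernel vector of the Gram matrix would then be a nonzero tangent vector orthogonal to everything.
-/
theorem metric_det_ne_zero (he : e ∈ IsManifold.maximalAtlas (𝓡 n) ∞ M) (hu : u ∈ e.target) :
    (metric h e u).det ≠ 0 := by
  intro hdet
  obtain ⟨c, hc, hc0⟩ := Matrix.exists_mulVec_eq_zero_iff.mpr hdet
  have hbij := (mdifferentiable_of_mem_maximalAtlas he).symm.mfderiv_bijective (x := u) hu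
  set L := mfderiv (𝓡 n) (𝓡 n) e.symm u with hL
  have hexp : ∀ d : Fin n → ℝ, L (∑ i, d i • EuclideanSpace.single i (1 : ℝ)) =
      ∑ i, d i • coordVec e u i := by
    intro d
    exact (map_sum L _ _).trans (Finset.sum_congr rfl fun i _ => map_smul L _ _)
  have hv : ∑ j, c j • coordVec e u j = 0 := by
    apply h.nondegenerate (e.symm u)
    intro w
    obtain ⟨y, rfl⟩ : ∃ y : EuclideanSpace ℝ (Fin n), L y = w := hbij.2 w
    have hy : ∑ i, y i • EuclideanSpace.single i (1 : ℝ) = y := by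
      ext k
      simp [Pi.single_apply]
    have hLy : L y = ∑ i, y i • coordVec e u i := (congrArg L hy.symm).trans (hexp y)
    rw [hLy]
    simp only [map_sum, map_smul, LinearMap.sum_apply, LinearMap.smul_apply, smul_eq_mul]
    refine Finset.sum_eq_zero fun i _ => ?_
    have h2 : ∑ j, c j * h.form (e.symm u) (coordVec e u j) (coordVec e u i) = 0 := by
      refine Eq.trans (Finset.sum_congr rfl fun j _ => ?_) (congrFun hc0 i)
      rw [h.symm, mul_comm]
      rfl
    rw [h2, mul_zero]
  apply hc
  rw [← hexp] at hv
  have h0 : (∑ i, c i • EuclideanSpace.single i (1 : ℝ) : EuclideanSpace ℝ (Fin n)) = 0 :=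
    hbij.1 (hv.trans (map_zero L).symm)
  funext k
  have := congrArg (fun z : EuclideanSpace ℝ (Fin n) => z k) h0
  simpa [Pi.single_apply] using this

theorem invMetric_mul_metric (he : e ∈ IsManifold.maximalAtlas (𝓡 n) ∞ M) (hu : u ∈ e.target) :
    invMetric h e u * metric h e u = 1 :=
  Matrix.nonsing_inv_mul _ (metric_det_ne_zero he hu).isUnit

theorem metric_mul_invMetric (he : e ∈ IsManifold.maximalAtlas (𝓡 n) ∞ M) (hu : u ∈ e.target) :
    metric h e u * invMetric h e u = 1 :=
  Matrix.mul_nonsing_inv _ (metric_det_ne_zero he hu).isUnit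

theorem invMetric_symm (i j : Fin n) : invMetric h e u i j = invMetric h e u j i := by
  have h1 : (metric h e u)ᵀ = metric h e u := Matrix.ext fun i j => metric_symm j i
  have h2 : (invMetric h e u)ᵀ = invMetric h e u := by
    unfold invMetric
    rw [Matrix.transpose_nonsing_inv, h1]
  exact congrFun (congrFun h2 j) i

theorem metric_smooth (he : e ∈ IsManifold.maximalAtlas (𝓡 n) ∞ M) :
    MSmooth (metric h e) e.target :=
  fun i j => h.smooth e he i j

theorem invMetric_smooth (he : e ∈ IsManifold.maximalAtlas (𝓡 n) ∞ M) :
    MSmooth (invMetric h e) e.target :=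
  (metric_smooth he).inv fun _ hv => metric_det_ne_zero he hv

/-- Connection matrices `(Γ_i)^l_k = Γ^l_{ik}` of the Levi-Civita connection. -/
def connMat (h : PseudoRiemannianMetric n M)
    (e : OpenPartialHomeomorph M (EuclideanSpace ℝ (Fin n))) (i : Fin n)
    (u : EuclideanSpace ℝ (Fin n)) : Matrix (Fin n) (Fin n) ℝ :=
  Matrix.of fun l k => christoffel h e u l i k

theorem connMat_smooth (he : e ∈ IsManifold.maximalAtlas (𝓡 n) ∞ M) (i : Fin n) :
    MSmooth (connMat h e i) e.target := by
  intro l k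
  have hd : ∀ a b c, ContDiffOn ℝ ∞ (fun u => pd a (fun v => metric h e v b c) u) e.target :=
    fun a b c => contDiffOn_pd e.open_target (metric_smooth he b c) a
  exact contDiffOn_const.mul (ContDiffOn.sum fun p _ =>
    (invMetric_smooth he l p).mul (((hd i k p).add (hd k i p)).sub (hd p i k)))

theorem connMat_symm (i j l : Fin n) : connMat h e i u l j = connMat h e j u l i := by
  simp only [connMat, Matrix.of_apply, christoffel]
  have h1 : ∀ p, pd p (fun v => metric h e v i j) u = pd p (fun v => metric h e v j i) u := by
    intro p
    simp only [metric_symm i j]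
  congr 1
  refine Finset.sum_congr rfl fun p _ => ?_
  rw [h1]
  ring

/-- These are the Christoffel symbols of the first kind: lowering the index cancels the inverse
metric. -/
theorem metric_mul_connMat (he : e ∈ IsManifold.maximalAtlas (𝓡 n) ∞ M) (hu : u ∈ e.target)
    (i j k : Fin n) : (metric h e u * connMat h e i u) j k =
      (1 / 2) * (pd i (fun v => metric h e v k j) u + pd k (fun v => metric h e v i j) u
      - pd j (fun v => metric h e v i k) u) := by
  set w : Fin n → ℝ := fun l => (1 / 2) * (pd i (fun v => metric h e v k l) u
    + pd k (fun v => metric h e v i l) u - pd l (fun v => metric h e v i k) u) with hw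
  have h1 : (fun l => connMat h e i u l k) = invMetric h e u *ᵥ w := by
    funext l
    simp only [connMat, Matrix.of_apply, christoffel, Matrix.mulVec, dotProduct, hw,
      Finset.mul_sum]
    refine Finset.sum_congr rfl fun p _ => ?_
    ring
  have h2 : (metric h e u * connMat h e i u) j k =
      (metric h e u *ᵥ fun l => connMat h e i u l k) j := rfl
  rw [h2, h1, Matrix.mulVec_mulVec, metric_mul_invMetric he hu, Matrix.one_mulVec]

/-- In the sum of two first-kind symbols with outer indices exchanged, all but one derivative of the
metric cancel. -/
theorem connMat_compat (he : e ∈ IsManifold.maximalAtlas (𝓡 n) ∞ M) (hu : u ∈ e.target)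
    (i : Fin n) : mpd i (metric h e) u =
      (connMat h e i u)ᵀ * metric h e u + metric h e u * connMat h e i u := by
  have h1 : (connMat h e i u)ᵀ * metric h e u = (metric h e u * connMat h e i u)ᵀ := by
    rw [Matrix.transpose_mul, show (metric h e u)ᵀ = metric h e u from
      Matrix.ext fun i j => metric_symm j i]
  ext j k
  rw [h1, Matrix.add_apply, Matrix.transpose_apply, metric_mul_connMat he hu,
    metric_mul_connMat he hu]
  have h2 : pd i (fun v => metric h e v k j) u = pd i (fun v => metric h e v j k) u := by
    simp only [metric_symm k j]
  rw [h2]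
  simp only [mpd, Matrix.of_apply]
  ring

theorem mpd_invMetric (he : e ∈ IsManifold.maximalAtlas (𝓡 n) ∞ M) (hu : u ∈ e.target)
    (i : Fin n) : mpd i (invMetric h e) u =
      -(connMat h e i u * invMetric h e u) - invMetric h e u * (connMat h e i u)ᵀ :=
  mpd_inv e.open_target (metric_smooth he) (invMetric_smooth he)
    (fun _ hv => metric_mul_invMetric he hv) hu i (connMat_compat he hu i)

theorem riemannUp_eq_curv (i j k l : Fin n) :
    riemannUp h e u i j k l = curv (connMat h e) i j u l k := by
  simp only [riemannUp, curv, Matrix.add_apply, Matrix.sub_apply, Matrix.mul_apply, mpd,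
    Matrix.of_apply, connMat, Finset.sum_sub_distrib]

theorem riemann_eq_metric_mul_curv (i j k l : Fin n) :
    riemann h e u i j k l = (metric h e u * curv (connMat h e) i j u) l k := by
  simp only [riemann, riemannUp_eq_curv, Matrix.mul_apply]
  exact Finset.sum_congr rfl fun p _ => by rw [metric_symm p l, mul_comm]

theorem riemann_antisymm_left (i j k l : Fin n) :
    riemann h e u i j k l = -riemann h e u j i k l := by
  rw [riemann_eq_metric_mul_curv, riemann_eq_metric_mul_curv, curv_antisymm, mul_neg]
  rfl

theorem riemann_antisymm_right (he : e ∈ IsManifold.maximalAtlas (𝓡 n) ∞ M) (hu : u ∈ e.target)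
    (i j k l : Fin n) : riemann h e u i j k l = -riemann h e u i j l k := by
  rw [riemann_eq_metric_mul_curv, riemann_eq_metric_mul_curv]
  have h1 := curv_metric_antisymm e.open_target (connMat_smooth (h := h) he) (metric_smooth he)
    (fun v hv i => connMat_compat he hv i) hu i j
  have h2 : (curv (connMat h e) i j u)ᵀ * metric h e u =
      (metric h e u * curv (connMat h e) i j u)ᵀ := by
    rw [Matrix.transpose_mul, show (metric h e u)ᵀ = metric h e u from
      Matrix.ext fun i j => metric_symm j i]
  rw [h2] at h1
  have := congrFun (congrFun h1 l) k
  simp only [Matrix.add_apply, Matrix.transpose_apply, Matrix.zero_apply] at this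
  linarith

theorem ricci_eq_ricMat (he : e ∈ IsManifold.maximalAtlas (𝓡 n) ∞ M) (hu : u ∈ e.target)
    (i j : Fin n) : ricci h e u i j = ricMat (connMat h e) u i j := by
  simp only [ricci, ricTr, ricMat, Matrix.of_apply]
  refine Finset.sum_congr rfl fun p _ => ?_
  have h1 : ∑ q, invMetric h e u p q * riemann h e u p i j q =
      (invMetric h e u * (metric h e u * curv (connMat h e) p i u)) p j := by
    rw [Matrix.mul_apply]
    exact Finset.sum_congr rfl fun q _ => by rw [riemann_eq_metric_mul_curv]
  rw [h1, ← mul_assoc, invMetric_mul_metric he hu, one_mul]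

theorem pd_scalar (he : e ∈ IsManifold.maximalAtlas (𝓡 n) ∞ M) (hu : u ∈ e.target) (a : Fin n) :
    pd a (scalar h e) u = 2 * divMat (connMat h e) (invMetric h e) (ricMat (connMat h e)) a u := by
  have hΓ := connMat_smooth (h := h) he
  rw [← contracted_bianchi e.open_target hΓ (invMetric_smooth he)
    (fun a b p => connMat_symm a b p) invMetric_symm (mpd_invMetric he hu)
    (fun v hv i j => curv_inv_antisymm (metric_mul_invMetric he hv)
      (curv_metric_antisymm e.open_target hΓ (metric_smooth he)
        (fun v hv i => connMat_compat he hv i) hv i j)) hu,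
    ← pd_trace e.open_target (invMetric_smooth he) (ricMat_smooth e.open_target hΓ) hu a
      (mpd_invMetric he hu a)]
  -- The two functions are known to agree on the chart's target; as it is open, their derivatives
  -- agree there.
  refine pd_congr a (Filter.Eventually.mono (e.open_target.mem_nhds hu) fun v hv => ?_)
  simp only [scalar, ricci_eq_ricMat he hv]

end Geometry

/-! ### Divergence of the tensor $\omega_i{}^P\omega_{jP}$. -/

section SymmetricTensor

variable {n m : ℕ} {M : Type*} [TopologicalSpace M] [ChartedSpace (EuclideanSpace ℝ (Fin n)) M]
  {h : PseudoRiemannianMetric n M} {e : OpenPartialHomeomorph M (EuclideanSpace ℝ (Fin n))}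
  {u : EuclideanSpace ℝ (Fin n)} {α : TensorField n M (m + 2)}

/-- The tensor `α_i^A α_{jA}`. -/
def tailMat (h : PseudoRiemannianMetric n M)
    (e : OpenPartialHomeomorph M (EuclideanSpace ℝ (Fin n))) (α : TensorField n M (m + 2))
    (u : EuclideanSpace ℝ (Fin n)) : Matrix (Fin n) (Fin n) ℝ :=
  Matrix.of fun i j => contrTail (invMetric h e u) (comp α e u) i j

theorem contr_smooth {k : ℕ} {U : Set (EuclideanSpace ℝ (Fin n))}
    {G : EuclideanSpace ℝ (Fin n) → Matrix (Fin n) (Fin n) ℝ}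
    {A B : EuclideanSpace ℝ (Fin n) → (Fin k → Fin n) → ℝ} (hG : MSmooth G U)
    (hA : ∀ P, ContDiffOn ℝ ∞ (fun v => A v P) U) (hB : ∀ P, ContDiffOn ℝ ∞ (fun v => B v P) U) :
    ContDiffOn ℝ ∞ (fun v => contr (G v) (A v) (B v)) U :=
  ContDiffOn.sum fun P _ => ContDiffOn.sum fun Q _ =>
    ((contDiffOn_prod fun s _ => hG (P s) (Q s)).mul (hA P)).mul (hB Q)

theorem tailMat_smooth (hα : IsSymTraceFree h α) (he : e ∈ IsManifold.maximalAtlas (𝓡 n) ∞ M) :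
    MSmooth (tailMat h e α) e.target := fun _ _ =>
  contr_smooth (invMetric_smooth he) (fun _ => hα.smooth e he _) (fun _ => hα.smooth e he _)

theorem comp_symm (hα : IsSymTraceFree h α) (σ : Equiv.Perm (Fin (m + 2)))
    (a : Fin (m + 2) → Fin n) : comp α e u (fun s => a (σ s)) = comp α e u a :=
  hα.symm _ σ fun s => coordVec e u (a s)

theorem covDeriv_eq_covArr : covDeriv h e α u = covArr (connMat h e) (comp α e) u := rfl

/-- With its first index frozen, the array is differentiated as one of lower rank; the last sum
restores the correction thereby omitted. -/
theorem covArr_vecCons (i j : Fin n) (P : Fin (m + 1) → Fin n) :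
    covArr (connMat h e) (fun v P => comp α e v (Matrix.vecCons i P)) u j P =
      covDeriv h e α u j (Matrix.vecCons i P)
        + ∑ p, connMat h e j u p i * comp α e u (Matrix.vecCons p P) := by
  have h0 : ∀ p, Function.update (Matrix.vecCons i P) 0 p = Matrix.vecCons p P :=
    fun p => Fin.update_cons_zero (α := fun _ => Fin n) i P p
  have h1 : ∀ (s : Fin (m + 1)) p, Function.update (Matrix.vecCons i P) s.succ p =
      Matrix.vecCons i (Function.update P s p) :=
    fun s p => (Fin.cons_update (α := fun _ => Fin n) i P s p).symm
  simp only [covArr, covDeriv]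
  conv_rhs => rw [Fin.sum_univ_succ]
  simp only [h0, h1, Matrix.cons_val_zero, Matrix.cons_val_succ, connMat, Matrix.of_apply]
  ring

/-- The corrections for the frozen indices are exactly the Christoffel terms in `covMat`. -/
theorem covMat_tailMat (hα : IsSymTraceFree h α) (he : e ∈ IsManifold.maximalAtlas (𝓡 n) ∞ M)
    (hu : u ∈ e.target) (j i k : Fin n) :
    covMat (connMat h e) j (tailMat h e α) u i k =
      contr (invMetric h e u) (fun P => covDeriv h e α u j (Matrix.vecCons i P))
        (fun P => comp α e u (Matrix.vecCons k P))
      + contr (invMetric h e u) (fun P => comp α e u (Matrix.vecCons i P))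
        (fun P => covDeriv h e α u j (Matrix.vecCons k P)) := by
  have h1 : mpd j (tailMat h e α) u i k =
      contr (invMetric h e u)
        (covArr (connMat h e) (fun v P => comp α e v (Matrix.vecCons i P)) u j)
        (fun P => comp α e u (Matrix.vecCons k P))
      + contr (invMetric h e u) (fun P => comp α e u (Matrix.vecCons i P))
        (covArr (connMat h e) (fun v P => comp α e v (Matrix.vecCons k P)) u j) :=
    pd_contr e.open_target (invMetric_smooth he) (fun _ => hα.smooth e he _)
      (fun _ => hα.smooth e he _) hu j (mpd_invMetric he hu j)
  have h2 : ∀ i, covArr (connMat h e) (fun v P => comp α e v (Matrix.vecCons i P)) u j =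
      fun P => covDeriv h e α u j (Matrix.vecCons i P)
        + ∑ p, connMat h e j u p i * comp α e u (Matrix.vecCons p P) :=
    fun i => funext fun P => covArr_vecCons i j P
  rw [h2, h2, contr_add_left, contr_sum_left] at h1
  rw [contr_transpose _ (fun P => comp α e u (Matrix.vecCons i P)), contr_add_left,
    ← contr_transpose, ← contr_transpose, contr_sum_right] at h1
  simp only [covMat, Matrix.sub_apply, Matrix.mul_apply, Matrix.transpose_apply]
  rw [h1]
  have h3 : ∑ p, tailMat h e α u i p * connMat h e j u p k =
      ∑ p, connMat h e j u p k * contr (invMetric h e u)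
        (fun P => comp α e u (Matrix.vecCons i P)) (fun P => comp α e u (Matrix.vecCons p P)) :=
    Finset.sum_congr rfl fun p _ => mul_comm _ _
  rw [h3]
  simp only [tailMat, Matrix.of_apply, contrTail]
  ring

theorem divMat_tailMat (hα : IsSymTraceFree h α) (he : e ∈ IsManifold.maximalAtlas (𝓡 n) ∞ M)
    (hu : u ∈ e.target) (a : Fin n) :
    divMat (connMat h e) (invMetric h e) (tailMat h e α) a u =
      contr (invMetric h e u)
        (fun P => covDeriv h e α u (P 0) (Matrix.vecCons a fun s => P s.succ)) (comp α e u)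
      + divCons h e α u a := by
  have h1 : divCons h e α u a = ∑ c, ∑ k, invMetric h e u c k *
      contr (invMetric h e u) (fun P => comp α e u (Matrix.vecCons a P))
        (fun P => covDeriv h e α u c (Matrix.vecCons k P)) := by
    unfold divCons
    simp only [← contr_sum_right]
    have := contr_sum_right (g := invMetric h e u) Finset.univ (fun _ => (1 : ℝ))
      (fun P => comp α e u (Matrix.vecCons a P))
      (fun c P => ∑ k, invMetric h e u c k * covDeriv h e α u c (Matrix.vecCons k P))
    simp only [one_mul] at this
    rw [← this]
    rfl
  rw [contr_succ, h1, ← Finset.sum_add_distrib]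
  refine Finset.sum_congr rfl fun c _ => ?_
  rw [← Finset.sum_add_distrib]
  refine Finset.sum_congr rfl fun k _ => ?_
  rw [covMat_tailMat hα he hu, mul_add]
  rfl

theorem pd_normSq (hα : IsSymTraceFree h α) (he : e ∈ IsManifold.maximalAtlas (𝓡 n) ∞ M)
    (hu : u ∈ e.target) (a : Fin n) :
    pd a (normSq h e α) u =
      2 * contr (invMetric h e u) (covDeriv h e α u a) (comp α e u) := by
  have h1 := pd_contr e.open_target (invMetric_smooth (h := h) he) (hα.smooth e he)
    (hα.smooth e he) hu a (mpd_invMetric he hu a)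
  rw [← covDeriv_eq_covArr] at h1
  change pd a (fun v => contr (invMetric h e v) (comp α e v) (comp α e v)) u = _
  rw [h1, contr_comm invMetric_symm (comp α e u)]
  ring

theorem klieCons_of_divFree (he : e ∈ IsManifold.maximalAtlas (𝓡 n) ∞ M)
    (hdiv : IsDivFree h α) (hu : u ∈ e.target) (a : Fin n) :
    klieCons h e α u a =
      (1 / 2) * (contr (invMetric h e u) (covDeriv h e α u a) (comp α e u)
        - contr (invMetric h e u)
          (fun P => covDeriv h e α u (P 0) (Matrix.vecCons a fun s => P s.succ))
          (comp α e u)) := by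
  have h1 : ∀ P : Fin (m + 2) → Fin n, klie h e α u a (P 0) (fun s => P s.succ) =
      (1 / 2) * (covDeriv h e α u a P
        - covDeriv h e α u (P 0) (Matrix.vecCons a fun s => P s.succ)) := by
    intro P
    have hP : (Matrix.vecCons (P 0) fun s => P s.succ) = P := Matrix.cons_head_tail P
    simp only [klie, hdiv e he u hu, hP]
    simp
  unfold klieCons
  simp only [h1]
  rw [contr_comm invMetric_symm, contr_smul_left, contr_sub_left]

theorem divCons_of_divFree (he : e ∈ IsManifold.maximalAtlas (𝓡 n) ∞ M)
    (hdiv : IsDivFree h α) (hu : u ∈ e.target) (a : Fin n) : divCons h e α u a = 0 := by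
  have h1 : divergence h e α u = fun _ => 0 := funext fun A => hdiv e he u hu A
  unfold divCons
  rw [h1, contr_zero_right]

/-- If `α` is divergence free and `α^A K(α)_{iA} = 0`, the tensor `α_i^A α_{jA} - ½ |α|² h_{ij}` is
divergence free. -/
theorem divMat_tailMat_eq_pd_normSq (hα : IsSymTraceFree h α)
    (he : e ∈ IsManifold.maximalAtlas (𝓡 n) ∞ M) (hdiv : IsDivFree h α)
    (hk : KlieConsVanishes h α) (hu : u ∈ e.target) (a : Fin n) :
    divMat (connMat h e) (invMetric h e) (tailMat h e α) a u =
      (1 / 2) * pd a (normSq h e α) u := by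
  have h1 := klieCons_of_divFree he hdiv hu a
  -- This identifies $\omega^{cP}D_c\omega_{aP}$ with $\omega^{cP}D_a\omega_{cP}=\frac12
  -- D_a|\omega|^2$.
  rw [hk e he u hu] at h1
  rw [divMat_tailMat hα he hu, pd_normSq hα he hu, divCons_of_divFree he hdiv hu]
  linarith

end SymmetricTensor

/-! ### Passing between the two systems. -/

section Equations

variable {n m : ℕ} {M : Type*} [TopologicalSpace M] [ChartedSpace (EuclideanSpace ℝ (Fin n)) M]
  {h : PseudoRiemannianMetric n M} {e : OpenPartialHomeomorph M (EuclideanSpace ℝ (Fin n))}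
  {u : EuclideanSpace ℝ (Fin n)} {α : TensorField n M (m + 2)} {c : ℝ}

theorem ricTr_omegaWedge (hα : IsSymTraceFree h α) (he : e ∈ IsManifold.maximalAtlas (𝓡 n) ∞ M)
    (hu : u ∈ e.target) (i j : Fin n) :
    ricTr (invMetric h e u) (omegaWedge h e α u) i j = tailMat h e α u i j :=
  ricTr_kwedge_self invMetric_symm (comp_symm hα) (hα.traceFree e he u hu) i j

theorem ricTr_metricWedge (he : e ∈ IsManifold.maximalAtlas (𝓡 n) ∞ M) (hu : u ∈ e.target)
    (i j : Fin n) :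
    ricTr (invMetric h e u)
      (kwedge (invMetric h e u) (metricArr h e u) (metricArr h e u)) i j =
      (1 - (n : ℝ)) * metric h e u i j :=
  ricTr_kwedge_metric metric_symm (invMetric_mul_metric he hu) i j

theorem sum_invMetric_mul_metric (he : e ∈ IsManifold.maximalAtlas (𝓡 n) ∞ M)
    (hu : u ∈ e.target) : ∑ i, ∑ j, invMetric h e u i j * metric h e u i j = n := by
  have h1 : ∀ i, ∑ j, invMetric h e u i j * metric h e u i j =
      (invMetric h e u * metric h e u) i i := by
    intro i
    rw [Matrix.mul_apply]
    exact Finset.sum_congr rfl fun j _ => by rw [metric_symm i j]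
  simp only [h1, invMetric_mul_metric he hu, Matrix.one_apply_eq]
  simp

theorem sum_invMetric_mul_tailMat :
    ∑ i, ∑ j, invMetric h e u i j * tailMat h e α u i j = normSq h e α u :=
  sum_contrTail _

theorem ricTr_sub_mul_add_mul (g : Matrix (Fin n) (Fin n) ℝ) (s t : ℝ)
    (X Y Z : Fin n → Fin n → Fin n → Fin n → ℝ) (i j : Fin n) :
    ricTr g (fun i j k l => X i j k l - s * Y i j k l + t * Z i j k l) i j =
      ricTr g X i j - s * ricTr g Y i j + t * ricTr g Z i j := by
  simp only [ricTr, Finset.mul_sum, ← Finset.sum_sub_distrib, ← Finset.sum_add_distrib]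
  refine Finset.sum_congr rfl fun p _ => Finset.sum_congr rfl fun q _ => ?_
  ring

theorem SolvesProjectiveHiggs.ricci_eq (hn : 2 ≤ n) (hα : IsSymTraceFree h α) {κ : M → ℝ}
    (hs : SolvesProjectiveHiggs h α c κ) (he : e ∈ IsManifold.maximalAtlas (𝓡 n) ∞ M)
    (hu : u ∈ e.target) (i j : Fin n) :
    ricci h e u i j = c * tailMat h e α u i j + κ (e.symm u) / n * metric h e u i j := by
  have hn0 : (n : ℝ) ≠ 0 := by positivity
  have hn1 : (n : ℝ) - 1 ≠ 0 := by
    have : (2 : ℝ) ≤ n := by exact_mod_cast hn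
    linarith
  have h1 := ricTr_sub_mul_add_mul (invMetric h e u) c
    (κ (e.symm u) / ((n : ℝ) * ((n : ℝ) - 1))) (riemann h e u) (omegaWedge h e α u)
    (kwedge (invMetric h e u) (metricArr h e u) (metricArr h e u)) i j
  have h2 : (fun i j k l => riemann h e u i j k l - c * omegaWedge h e α u i j k l
      + κ (e.symm u) / ((n : ℝ) * ((n : ℝ) - 1)) *
        kwedge (invMetric h e u) (metricArr h e u) (metricArr h e u) i j k l) =
      fun _ _ _ _ => 0 := by
    funext i j k l
    rw [hs e he u hu i j k l]
    ring
  rw [h2, ricTr_omegaWedge hα he hu, ricTr_metricWedge he hu] at h1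
  have h3 : ricTr (invMetric h e u) (fun _ _ _ _ => 0) i j = 0 := by simp [ricTr]
  have h4 : κ (e.symm u) / ((n : ℝ) * ((n : ℝ) - 1)) * ((1 - (n : ℝ)) * metric h e u i j) =
      -(κ (e.symm u) / n * metric h e u i j) := by
    field_simp
    ring
  rw [h3, h4] at h1
  unfold ricci
  linarith

theorem SolvesProjectiveHiggs.scalar_eq (hn : 2 ≤ n) (hα : IsSymTraceFree h α) {κ : M → ℝ}
    (hs : SolvesProjectiveHiggs h α c κ) (he : e ∈ IsManifold.maximalAtlas (𝓡 n) ∞ M)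
    (hu : u ∈ e.target) : scalar h e u = c * normSq h e α u + κ (e.symm u) := by
  have hn0 : (n : ℝ) ≠ 0 := by positivity
  unfold scalar
  simp only [hs.ricci_eq hn hα he hu, mul_add, mul_left_comm _ c,
    mul_left_comm _ (κ (e.symm u) / n), Finset.sum_add_distrib, ← Finset.mul_sum]
  rw [sum_invMetric_mul_metric he hu, sum_invMetric_mul_tailMat]
  field_simp

/-- The gradient of the scalar curvature is computed twice, from the traced equation and from the
contracted Bianchi identity. The difference is a multiple of $d\kappa$ that is nonzero unless $n=2$.
-/
theorem SolvesProjectiveHiggs.pd_eq_zero (hn : 3 ≤ n) (hα : IsSymTraceFree h α)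
    (hdiv : IsDivFree h α) (hk : KlieConsVanishes h α) {κ : M → ℝ}
    (hs : SolvesProjectiveHiggs h α c κ) (he : e ∈ IsManifold.maximalAtlas (𝓡 n) ∞ M)
    (hκ : ContDiffOn ℝ ∞ (fun v => κ (e.symm v)) e.target) (hu : u ∈ e.target) (a : Fin n) :
    pd a (fun v => κ (e.symm v)) u = 0 := by
  have hn2 : 2 ≤ n := by omega
  have hn3 : (3 : ℝ) ≤ n := by exact_mod_cast hn
  have hn0 : (n : ℝ) ≠ 0 := by linarith
  have hU := e.open_target
  have hev : ∀ᶠ v in 𝓝 u, v ∈ e.target := hU.mem_nhds hu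
  have hN : ContDiffOn ℝ ∞ (normSq h e α) e.target :=
    contr_smooth (invMetric_smooth he) (fun _ => hα.smooth e he _) (fun _ => hα.smooth e he _)
  have dκ := differentiableAt_of_smooth hU hκ hu
  have dN := differentiableAt_of_smooth hU hN hu
  have hκn : ContDiffOn ℝ ∞ (fun v => (n : ℝ)⁻¹ * κ (e.symm v)) e.target :=
    contDiffOn_const.mul hκ
  have h1 : pd a (scalar h e) u = c * pd a (normSq h e α) u + pd a (fun v => κ (e.symm v)) u := by
    rw [pd_congr a (hev.mono fun v hv => hs.scalar_eq hn2 hα he hv),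
      pd_add a (dN.const_mul c) dκ, pd_mul a (differentiableAt_const c) dN, pd_const]
    ring
  have hF := tailMat_smooth hα he
  have hH := metric_smooth (h := h) he
  have h2 : ∀ b, covMat (connMat h e) b (ricMat (connMat h e)) u =
      c • covMat (connMat h e) b (tailMat h e α) u
        + ((n : ℝ)⁻¹ * pd b (fun v => κ (e.symm v)) u) • metric h e u := by
    intro b
    have e1 : ∀ v ∈ e.target, ricMat (connMat h e) v =
        c • tailMat h e α v + ((n : ℝ)⁻¹ * κ (e.symm v)) • metric h e v := by
      intro v hv
      ext i j
      rw [← ricci_eq_ricMat he hv, hs.ricci_eq hn2 hα he hv]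
      simp only [Matrix.add_apply, Matrix.smul_apply, smul_eq_mul]
      ring
    have e2 : covMat (connMat h e) b (ricMat (connMat h e)) u =
        covMat (connMat h e) b
          (fun v => c • tailMat h e α v + ((n : ℝ)⁻¹ * κ (e.symm v)) • metric h e v) u := by
      unfold covMat
      rw [mpd_congr b (hev.mono e1), e1 u hu]
    rw [e2, covMat_add (F := fun v => c • tailMat h e α v)
      (F' := fun v => ((n : ℝ)⁻¹ * κ (e.symm v)) • metric h e v) hU
      (fun i j => contDiffOn_const.mul (hF i j)) (fun i j => hκn.mul (hH i j)) hu,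
      covMat_const_smul hU hF hu, covMat_smul_metric hU hκn hH hu b (connMat_compat he hu b),
      pd_mul b (differentiableAt_const _) dκ, pd_const]
    simp
  have h3 : divMat (connMat h e) (invMetric h e) (ricMat (connMat h e)) a u =
      c * divMat (connMat h e) (invMetric h e) (tailMat h e α) a u
        + (n : ℝ)⁻¹ * pd a (fun v => κ (e.symm v)) u := by
    have e1 : ∀ b, ∑ k, invMetric h e u b k *
        ((n : ℝ)⁻¹ * pd b (fun v => κ (e.symm v)) u * metric h e u a k) =
        (n : ℝ)⁻¹ * pd b (fun v => κ (e.symm v)) u *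
          (1 : Matrix (Fin n) (Fin n) ℝ) b a := by
      intro b
      rw [← invMetric_mul_metric (h := h) he hu, Matrix.mul_apply, Finset.mul_sum]
      refine Finset.sum_congr rfl fun k _ => ?_
      rw [metric_symm a k]
      ring
    unfold divMat
    simp only [h2, Matrix.add_apply, Matrix.smul_apply, smul_eq_mul, mul_add,
      Finset.sum_add_distrib, e1, mul_left_comm _ c, ← Finset.mul_sum, Matrix.one_apply]
    simp
  rw [pd_scalar he hu, h3, divMat_tailMat_eq_pd_normSq hα he hdiv hk hu] at h1
  have h4 : (2 * (n : ℝ)⁻¹ - 1) * pd a (fun v => κ (e.symm v)) u = 0 := by linarith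
  refine (mul_eq_zero.mp h4).resolve_left fun h5 => ?_
  field_simp at h5
  linarith

theorem SolvesProjectiveHiggs.exists_eq_const [IsManifold (𝓡 n) ∞ M] [ConnectedSpace M]
    (hn : 3 ≤ n) (hα : IsSymTraceFree h α) (hdiv : IsDivFree h α) (hk : KlieConsVanishes h α)
    {κ : M → ℝ} (hκ : ContMDiff (𝓡 n) 𝓘(ℝ, ℝ) ∞ κ) (hs : SolvesProjectiveHiggs h α c κ) :
    ∃ κ₀, ∀ x, κ x = κ₀ := by
  have hloc : IsLocallyConstant κ := by
    rw [IsLocallyConstant.iff_eventually_eq]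
    intro x
    set e := chartAt (EuclideanSpace ℝ (Fin n)) x
    have he : e ∈ IsManifold.maximalAtlas (𝓡 n) ∞ M := IsManifold.chart_mem_maximalAtlas x
    have hx : x ∈ e.source := mem_chart_source _ x
    have hsm : ContDiffOn ℝ ∞ (fun v => κ (e.symm v)) e.target :=
      (hκ.comp_contMDiffOn (contMDiffOn_symm_of_mem_maximalAtlas he)).contDiffOn
    have hfd : ∀ u ∈ e.target, fderiv ℝ (fun v => κ (e.symm v)) u = 0 := by
      intro u hu
      ext y
      have hy : ∑ i, y i • EuclideanSpace.single i (1 : ℝ) = y := by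
        ext k
        simp [Pi.single_apply]
      rw [← hy, map_sum]
      refine Finset.sum_eq_zero fun i _ => ?_
      rw [map_smul]
      have := hs.pd_eq_zero hn hα hdiv hk he hsm hu i
      unfold pd at this
      rw [this, smul_zero]
    -- The chart's target need not be connected, so the argument runs on a ball inside it.
    obtain ⟨r, hr, hball⟩ := Metric.isOpen_iff.mp e.open_target (e x) (e.map_source hx)
    filter_upwards [e.open_source.mem_nhds hx,
      (e.continuousAt hx).preimage_mem_nhds (Metric.ball_mem_nhds _ hr)] with y hys hyr
    have := Metric.isOpen_ball.is_const_of_fderiv_eq_zero (convex_ball (e x) r).isPreconnected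
      (fun v hv => ((hsm.differentiableOn (by simp)) v (hball hv)).mono hball)
      (fun v hv => hfd v (hball hv)) hyr (Metric.mem_ball_self hr)
    simpa only [e.left_inv hys, e.left_inv hx] using this
  obtain ⟨x₀⟩ := (inferInstance : Nonempty M)
  exact ⟨κ x₀, fun x => hloc.apply_eq_of_preconnectedSpace x x₀⟩

theorem SolvesProjectiveHiggs.solvesStressEnergy (hn : 2 ≤ n) (hα : IsSymTraceFree h α)
    (hdiv : IsDivFree h α) (hk : KlieConsVanishes h α) {κ₀ : ℝ}
    (hs : SolvesProjectiveHiggs h α c (fun _ => κ₀)) : SolvesStressEnergy h α c κ₀ := by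
  intro e he u hu
  refine ⟨fun i => ?_, fun i j => ?_⟩
  · rw [hk e he u hu, divCons_of_divFree he hdiv hu]
    ring
  · have hn0 : (n : ℝ) ≠ 0 := by positivity
    rw [hs.ricci_eq hn hα he hu, hs.scalar_eq hn hα he hu, stressPlus, ricTr_omegaWedge hα he hu]
    field_simp
    ring

/-- The trace of the Einstein equation is linear in the scalar curvature with coefficient $1-\frac
n2$, hence solvable. -/
theorem SolvesStressEnergy.scalar_eq (hn : 3 ≤ n) (hα : IsSymTraceFree h α) {κ₀ : ℝ}
    (hs : SolvesStressEnergy h α c κ₀) (he : e ∈ IsManifold.maximalAtlas (𝓡 n) ∞ M)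
    (hu : u ∈ e.target) : scalar h e u = c * normSq h e α u + κ₀ := by
  have hn3 : (3 : ℝ) ≤ n := by exact_mod_cast hn
  have hn0 : (n : ℝ) ≠ 0 := by linarith
  have h1 : ∀ i j, ricci h e u i j = (1 / 2 * scalar h e u - ((n : ℝ) - 2) / (2 * n) * κ₀
      - 1 / 2 * c * normSq h e α u) * metric h e u i j + c * tailMat h e α u i j := by
    intro i j
    have := (hs e he u hu).2 i j
    rw [stressPlus, ricTr_omegaWedge hα he hu] at this
    linarith
  have h2 : scalar h e u = (1 / 2 * scalar h e u - ((n : ℝ) - 2) / (2 * n) * κ₀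
      - 1 / 2 * c * normSq h e α u) * n + c * normSq h e α u := by
    conv_lhs => unfold scalar
    simp only [h1]
    -- The coefficient is itself built from the scalar curvature; once named, it factors out of the
    -- sums as a constant.
    generalize 1 / 2 * scalar h e u - ((n : ℝ) - 2) / (2 * n) * κ₀
      - 1 / 2 * c * normSq h e α u = t
    simp only [mul_add, mul_left_comm _ c, mul_left_comm _ t, Finset.sum_add_distrib,
      ← Finset.mul_sum]
    rw [sum_invMetric_mul_metric he hu, sum_invMetric_mul_tailMat]
  have h3 : ((n : ℝ) - 2) * (scalar h e u - (c * normSq h e α u + κ₀)) = 0 := by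
    field_simp at h2
    linarith
  have := (mul_eq_zero.mp h3).resolve_left (by linarith)
  linarith

/-- Inserting the known scalar curvature into the Einstein equation makes the Ricci trace of the
difference tensor vanish, so the three-dimensional rigidity applies. -/
theorem SolvesStressEnergy.solvesProjectiveHiggs {M : Type*} [TopologicalSpace M]
    [ChartedSpace (EuclideanSpace ℝ (Fin 3)) M] {h : PseudoRiemannianMetric 3 M}
    {α : TensorField 3 M (m + 2)} (hα : IsSymTraceFree h α) {κ₀ : ℝ}
    (hs : SolvesStressEnergy h α c κ₀) : SolvesProjectiveHiggs h α c (fun _ => κ₀) := by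
  intro e he u hu i j k l
  have hdet : (invMetric h e u).det ≠ 0 := by
    have := Matrix.isUnit_nonsing_inv_det _ (metric_det_ne_zero (h := h) he hu).isUnit
    exact this.ne_zero
  have h0 := eq_zero_of_ricTr_eq_zero invMetric_symm hdet
    (Y := fun i j k l => riemann h e u i j k l - c * omegaWedge h e α u i j k l
      + κ₀ / (((3 : ℕ) : ℝ) * (((3 : ℕ) : ℝ) - 1)) *
        kwedge (invMetric h e u) (metricArr h e u) (metricArr h e u) i j k l)
    (fun i j k l => by
      rw [riemann_antisymm_left, omegaWedge, kwedge_antisymm_left,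
        kwedge_antisymm_left (metricArr h e u), omegaWedge]
      ring)
    (fun i j k l => by
      rw [riemann_antisymm_right he hu, omegaWedge, kwedge_antisymm_right,
        kwedge_antisymm_right (metricArr h e u), omegaWedge]
      ring)
    (fun i j => by
      have h1 := (hs e he u hu).2 i j
      rw [stressPlus, hs.scalar_eq le_rfl hα he hu] at h1
      rw [ricTr_sub_mul_add_mul, ricTr_metricWedge he hu]
      change ricci h e u i j - _ + _ = 0
      push_cast at h1 ⊢
      linarith) i j k l
  linarith

end Equations

end EinsteinTensor

end

theorem mainTheorem7 {n m : ℕ} (hn : 3 ≤ n) {M : Type*} [TopologicalSpace M] [ConnectedSpace M]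
    [ChartedSpace (EuclideanSpace ℝ (Fin n)) M] [IsManifold (𝓡 n) ∞ M]
    (h : EinsteinTensor.PseudoRiemannianMetric n M)
    (α : EinsteinTensor.TensorField n M (m + 2))
    (hα : EinsteinTensor.IsSymTraceFree h α) :
    (EinsteinTensor.IsDivFree h α → EinsteinTensor.KlieConsVanishes h α →
      ∀ (c : ℝ) (κ : M → ℝ), ContMDiff (𝓡 n) 𝓘(ℝ, ℝ) ∞ κ →
        EinsteinTensor.SolvesProjectiveHiggs h α c κ →
        ∃ κ₀ : ℝ, (∀ x, κ x = κ₀) ∧ EinsteinTensor.SolvesStressEnergy h α c κ₀) ∧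
    (n = 3 →
      (∀ c κ₀ : ℝ, EinsteinTensor.SolvesStressEnergy h α c κ₀ →
        EinsteinTensor.SolvesProjectiveHiggs h α c (fun _ => κ₀)) ∧
      (EinsteinTensor.IsDivFree h α → EinsteinTensor.KlieConsVanishes h α →
        ∀ (c : ℝ) (κ : M → ℝ), ContMDiff (𝓡 n) 𝓘(ℝ, ℝ) ∞ κ →
          (EinsteinTensor.SolvesProjectiveHiggs h α c κ ↔
            ∃ κ₀ : ℝ, (∀ x, κ x = κ₀) ∧ EinsteinTensor.SolvesStressEnergy h α c κ₀))) := by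
  have hA : EinsteinTensor.IsDivFree h α → EinsteinTensor.KlieConsVanishes h α →
      ∀ (c : ℝ) (κ : M → ℝ), ContMDiff (𝓡 n) 𝓘(ℝ, ℝ) ∞ κ →
        EinsteinTensor.SolvesProjectiveHiggs h α c κ →
        ∃ κ₀ : ℝ, (∀ x, κ x = κ₀) ∧ EinsteinTensor.SolvesStressEnergy h α c κ₀ := by
    intro hdiv hk c κ hκ hs
    obtain ⟨κ₀, hκ₀⟩ := hs.exists_eq_const hn hα hdiv hk hκ
    obtain rfl : κ = fun _ => κ₀ := funext hκ₀
    exact ⟨κ₀, hκ₀, hs.solvesStressEnergy (by omega) hα hdiv hk⟩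
  refine ⟨hA, ?_⟩
  rintro rfl
  refine ⟨fun c κ₀ hs => hs.solvesProjectiveHiggs hα, fun hdiv hk c κ hκ =>
    ⟨hA hdiv hk c κ hκ, ?_⟩⟩
  rintro ⟨κ₀, hκ₀, hs⟩
  obtain rfl : κ = fun _ => κ₀ := funext hκ₀
  exact hs.solvesProjectiveHiggs hα
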